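/- Let $\mathbb{T}=abacabaabacab\cdots$ be the Tribonacci sequence, the fixed point of $\sigma:a\mapsto ab,\ b\mapsto ac,\ c\mapsto a$, with positions numbered from $1$; let $T_m=\sigma^m(a)$ and $t_m=|T_m|$ ($m\ge 0$). For a nonempty word $\omega$, let $\omega_p$ be its $p$-th occurrence in $\mathbb{T}$ and $P(\omega,p)$ the position of the last letter of $\omega_p$. A square occurrence is a pair $(\omega,p)$ such that $\omega_{p+1}$ starts right after the end of $\omega_p$; it ends at position $P(\omega,p+1)$. Let $b(n)$ be the number of square occurrences ending at position $n$, and $B(n)$ the number of those ending at a position $\le n$. Let $k_0=0$, $k_1=k_2=1$, $k_m=k_{m-1}+k_{m-2}+k_{m-3}-1$ for $m\ge3$; for $m\ge 4$ let $K_m$ be the last letter of $T_{m-1}$ followed by the prefix of $T_{m-3}$ of length $k_m-1$, and put $P=P(K_m,1)$, $$\Gamma_{1,m}=[P+t_{m-1}-t_{m-2},\dots,P+t_{m-1}-1],\quad \Gamma_{2,m}=[P-t_m+2t_{m-1},\dots,P+t_{m-1}-t_{m-2}-1],\quad \Gamma_{3,m}=[P,\dots,P-t_m+2t_{m-1}-1]$$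 (these are the blocks $\Gamma_{j,m,1}$). For a vector $\Gamma$ of positions let $b(\Gamma)$ be the vector of the values of $b$ and $\sum b(\Gamma)$ the sum of its entries. Let $\Phi_m=\sum_{j=1}^3\sum b(\Gamma_{j,m})$ and $S_{j,m}(n)=\sum_{i=\min\Gamma_{j,m}}^{n}b(i)$. In formulas at level $m$ write $x=t_m$, $y=t_{m-1}$, $z=t_{m-2}$. Then the following hold. **(0)** $B(n)=\sum_{i=1}^n b(i)$ for all $n$. For $m\ge4$: $\min\Gamma_{3,m}=\theta^1_m:=\frac{x+z-1}2$; $\max\Gamma_{3,m}+1=\min\Gamma_{2,m}=\theta^4_m:=\frac{-x+4y+z-1}2$; $\max\Gamma_{2,m}+1=\min\Gamma_{1,m}=\theta^7_m:=\frac{x+2y-z-1}2$; $\max\Gamma_{1,m}+1=\theta^{10}_m:=\frac{x+2y+z-1}2$; and $|\Gamma_{1,m}|=t_{m-2}$, $|\Gamma_{2,m}|=t_{m-3}$, $|\Gamma_{3,m}|=t_{m-4}$. Every $n\ge 8$ lies in exactly one block $\Gamma_{j,m}$ ($1\le j\le 3$, $m\ge4$). If $n\in\Gamma_{j,m}$ and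 $n\ge52$, then $m\ge7$; if $n\in\Gamma_{2,m}$ and $n\ge32$, then $m\ge6$; if $n\in\Gamma_{1,m}$ and $n\ge21$, then $m\ge5$. **(1) Recursive description of $b$.** $b(i)=0$ for $i\le7$, $b([8])=[1]$, $b([9,10])=[0,1]$, $b([11,\dots,14])=[0,0,0,1]$, $b([15,16])=[1,1]$, $b([17,\dots,20])=[0,0,1,1]$, $b([28,\dots,31])=[1,1,1,1]$; and, with $V_m=[b(\Gamma_{3,m}),b(\Gamma_{2,m}),b(\Gamma_{1,m})]$ (concatenation), $$b(\Gamma_{1,m})=V_{m-1}+[\underbrace{0,\dots,0}_{t_{m-2}-k_m+1},\underbrace{1,\dots,1}_{k_m-1}]\ (m\ge5),\qquad b(\Gamma_{2,m})=V_{m-2}+[\underbrace{0,\dots,0}_{t_{m-3}-k_m+1},\underbrace{1,\dots,1}_{k_m-1}]\ (m\ge6),$$ $$b(\Gamma_{3,m})=V_{m-3}+[\underbrace{1,\dots,1}_{t_{m-4}-k_{m-3}+1},\underbrace{0,\dots,0}_{k_{m-3}-1}]\ (m\ge7).$$ **(2) Closed forms.** For $m\ge4$: - $\Phi_m=\frac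 m{22}(-5x+14y+4z)+\frac1{44}(67x-166y+5z)+\frac14$; - $\sum b(\Gamma_{1,m})=\frac m{22}(4x-9y+10z)+\frac1{44}(19x+36y-169z)-\frac14$; - $\sum b(\Gamma_{2,m})=\frac m{22}(10x-6y-19z)+\frac1{44}(-189x+156y+331z)-\frac14$; - $\sum b(\Gamma_{3,m})=\frac m{22}(-19x+29y+13z)+\frac1{44}(237x-358y-157z)+\frac34$; - $\sum_{i=4}^{m-1}\Phi_i=\frac m{44}(13x-10y+5z)+\frac2{11}(-8x+8y-7z)+\frac m4+2$; - $B(\max\Gamma_{3,m})=\frac m{44}(-25x+48y+31z)+\frac1{44}(173x-294y-213z)+\frac{m+11}4$; - $B(\max\Gamma_{2,m})=\frac m{44}(-5x+36y-7z)+\frac1{22}(-8x-69y+59z)+\frac{m+10}4$; - $B(\max\Gamma_{1,m})=\frac m{44}(3x+18y+13z)+\frac1{44}(3x-102y-51z)+\frac{m+9}4$. **(3) Reduction on $\Gamma_{3,m}$.** Let $m\ge7$, $\theta^2_m=\frac{-5x+10y+3z-1}2$, $\theta^3_m=\frac{-x+6y-3z-1}2$, $\eta^1_m=-2x+5y$.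 Then $\theta^2_m=\min\Gamma_{3,m}+|\Gamma_{3,m-3}|$, $\theta^3_m=\theta^2_m+|\Gamma_{2,m-3}|$, $\eta^1_m=\min\Gamma_{3,m}+t_{m-4}-k_{m-3}+1$, $\theta^3_m<\eta^1_m<\theta^4_m$, $\min\Gamma_{3,m}=\min\Gamma_{3,m-3}+t_{m-1}$, and for $n\in\Gamma_{3,m}$, with $n'=n-t_{m-1}$, $$S_{3,m}(n)=\begin{cases}S_{3,m-3}(n')+n-\min\Gamma_{3,m}+1,&n<\theta^2_m;\\ S_{2,m-3}(n')+\sum b(\Gamma_{3,m-3})+n-\min\Gamma_{3,m}+1,&\theta^2_m\le n<\theta^3_m;\\ S_{1,m-3}(n')+\sum b(\Gamma_{3,m-3})+\sum b(\Gamma_{2,m-3})+n-\min\Gamma_{3,m}+1,&\theta^3_m\le n<\eta^1_m;\\ S_{1,m-3}(n')+\sum b(\Gamma_{3,m-3})+\sum b(\Gamma_{2,m-3})+\frac{-5x+10y-z+1}2,&\text{otherwise.}\end{cases}$$ **(4) Reduction on $\Gamma_{2,m}$.** Let $m\ge6$, $\theta^5_m=\frac{3x-5z-1}2$, $\eta^2_m=2y-z$,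 $\theta^6_m=\frac{3x-2y-z-1}2$. Then $\theta^5_m=\min\Gamma_{2,m}+|\Gamma_{3,m-2}|$, $\theta^6_m=\theta^5_m+|\Gamma_{2,m-2}|$, $\eta^2_m=\min\Gamma_{2,m}+t_{m-3}-k_m+1$, $\theta^5_m<\eta^2_m\le\theta^6_m$, $\min\Gamma_{2,m}=\min\Gamma_{3,m-2}+t_{m-1}$, and for $n\in\Gamma_{2,m}$, with $n'=n-t_{m-1}$, $$S_{2,m}(n)=\begin{cases}S_{3,m-2}(n'),&n<\theta^5_m;\\ S_{2,m-2}(n')+\sum b(\Gamma_{3,m-2}),&\theta^5_m\le n<\eta^2_m;\\ S_{2,m-2}(n')+\sum b(\Gamma_{3,m-2})+n-\eta^2_m+1,&\eta^2_m\le n<\theta^6_m;\\ S_{1,m-2}(n')+\sum b(\Gamma_{3,m-2})+\sum b(\Gamma_{2,m-2})+n-\eta^2_m+1,&\text{otherwise.}\end{cases}$$ **(5) Reduction on $\Gamma_{1,m}$.** Let $m\ge5$, $\theta^8_m=\frac{x+3z-1}2$, $\theta^9_m=\frac{-x+4y+3z-1}2$, $\eta^3_m=2y$. Then $\theta^8_m=\min\Gamma_{1,m}+|\Gamma_{3,m-1}|$,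 $\theta^9_m=\theta^8_m+|\Gamma_{2,m-1}|$, $\eta^3_m=\min\Gamma_{1,m}+t_{m-2}-k_m+1$, $\theta^9_m<\eta^3_m<\theta^{10}_m$, $\min\Gamma_{1,m}=\min\Gamma_{3,m-1}+t_{m-1}$, and for $n\in\Gamma_{1,m}$, with $n'=n-t_{m-1}$, $$S_{1,m}(n)=\begin{cases}S_{3,m-1}(n'),&n<\theta^8_m;\\ S_{2,m-1}(n')+\sum b(\Gamma_{3,m-1}),&\theta^8_m\le n<\theta^9_m;\\ S_{1,m-1}(n')+\sum b(\Gamma_{3,m-1})+\sum b(\Gamma_{2,m-1}),&\theta^9_m\le n<\eta^3_m;\\ S_{1,m-1}(n')+\sum b(\Gamma_{3,m-1})+\sum b(\Gamma_{2,m-1})+n-\eta^3_m+1,&\text{otherwise.}\end{cases}$$ **(6) Algorithm B.** For $n\in\Gamma_{j,m}$, $m\ge4$: $B(n)=B(\min\Gamma_{j,m}-1)+S_{j,m}(n)$. Evaluating $b(n)$ by the recursion (1), starting from the listed values, gives $b(n)$ correctly for every $n\ge 0$. The following algorithm returns $B(n)$ for every $n\ge0$: if $n\le51$, compute $\sum_{i=1}^n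 b(i)$ by (1); if $n\ge52$, find by upward search from $m=4$ the $j,m$ with $n\in\Gamma_{j,m}$, evaluate $B(\min\Gamma_{j,m}-1)$ by (2) (it is $B$ at the maximum of the preceding block $\Gamma_{2,m}$, $\Gamma_{3,m}$, $\Gamma_{1,m-1}$ for $j=1,2,3$), evaluate $S_{j,m}(n)$ by repeated reduction (3)–(5) with the complete block sums taken from (2), down to a block on which $b$ is listed in (1), and add. It is fast: the number of its search and reduction steps is $O(\log n)$ as $n\to\infty$, each step using a bounded number of arithmetic operations and comparisons. -/

import Mathlib

namespace TribSq

/-- The alphabet. -/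
inductive Letter
  | a
  | b
  | c
  deriving DecidableEq

/-- The substitution `a ↦ ab`, `b ↦ ac`, `c ↦ a` on letters. -/
def sub : Letter → List Letter
  | .a => [.a, .b]
  | .b => [.a, .c]
  | .c => [.a]

/-- `T_m = σ^m(a)`. -/
def word (m : ℕ) : List Letter :=
  (fun w : List Letter => w.flatMap sub)^[m] [Letter.a]

/-- The Tribonacci numbers `t_m = |T_m|`: `1, 2, 4, 7, 13, 24, …`. -/
def t (m : ℕ) : ℕ := (word m).length

/-- The Tribonacci sequence, the fixed point of the substitution, positions numbered from `1`.
Every `T_m` is a prefix of it and `|T_n| ≥ n + 1`, so its `n`-th letter is the `n`-th letter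
of `T_n`. The value at position `0` is never used. -/
def trib (n : ℕ) : Letter := (word n).getD (n - 1) Letter.a

/-- The factor of the Tribonacci sequence occupying the positions `i, …, j`. -/
def factor (i j : ℕ) : List Letter := (List.range' i (j + 1 - i)).map trib

/-- The word `w` occurs in the Tribonacci sequence with its last letter at position `n`. -/
def EndsAt (w : List Letter) (n : ℕ) : Prop :=
  w.length ≤ n ∧ factor (n - w.length + 1) n = w

/-- The `p`-th occurrence of `w` (counted from `1`) has its last letter at position `n`. -/
def IsOcc (w : List Letter) (p n : ℕ) : Prop :=
  EndsAt w n ∧ {i : ℕ | i ≤ n ∧ EndsAt w i}.ncard = p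

/-- `P(w, p)`: the position of the last letter of the `p`-th occurrence of `w`. -/
noncomputable def pos (w : List Letter) (p : ℕ) : ℕ := sInf {n : ℕ | IsOcc w p n}

/-- `w_p w_{p+1}` is a square ending at position `n`: the `p`-th and the `(p+1)`-st occurrence
of the nonempty word `w` are adjacent and the latter ends at `n`. -/
def SquareAt (w : List Letter) (p n : ℕ) : Prop :=
  w ≠ [] ∧ ∃ e : ℕ, IsOcc w p e ∧ IsOcc w (p + 1) (e + w.length) ∧ e + w.length = n

/-- `b(n)`: the number of square occurrences ending at position `n`. -/
noncomputable def b (n : ℕ) : ℕ := {x : List Letter × ℕ | SquareAt x.1 x.2 n}.ncard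

/-- `B(n)`: the number of square occurrences in the prefix of length `n`. -/
noncomputable def B (n : ℕ) : ℕ :=
  {x : List Letter × ℕ | ∃ e ≤ n, SquareAt x.1 x.2 e}.ncard

/-- The kernel numbers. -/
def k : ℕ → ℕ
  | 0 => 0
  | 1 => 1
  | 2 => 1
  | m + 3 => k (m + 2) + k (m + 1) + k m - 1

/-- The kernel words `K_m`, for `m ≥ 1`: `K_1 = a`, `K_2 = b`, `K_3 = c`, and for `m ≥ 4` the
last letter of `T_{m-1}` followed by the prefix of `T_{m-3}` of length `k_m - 1`. -/
def kernel : ℕ → List Letter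
  | 0 => []
  | 1 => [.a]
  | 2 => [.b]
  | 3 => [.c]
  | m + 4 => (word (m + 3)).getLastD .a :: (word (m + 1)).take (k (m + 4) - 1)

/-- The index `j ∈ {1, 2, 3}` of a block. -/
inductive Idx
  | one
  | two
  | three
  deriving DecidableEq

/-- The least element of the block `Γ_{j,m,p}`, for `m ≥ 4`. -/
noncomputable def gMin (j : Idx) (m p : ℕ) : ℕ :=
  match j with
  | .one => pos (kernel m) p + t (m - 1) - t (m - 2)
  | .two => pos (kernel m) p + 2 * t (m - 1) - t m
  | .three => pos (kernel m) p

/-- The greatest element of the block `Γ_{j,m,p}`, for `m ≥ 4`. -/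
noncomputable def gMax (j : Idx) (m p : ℕ) : ℕ :=
  match j with
  | .one => pos (kernel m) p + t (m - 1) - 1
  | .two => pos (kernel m) p + t (m - 1) - t (m - 2) - 1
  | .three => pos (kernel m) p + 2 * t (m - 1) - t m - 1

/-- The block `Γ_{j,m,p} = [min, …, max]`, a vector of consecutive positions. -/
noncomputable def block (j : Idx) (m p : ℕ) : List ℕ :=
  List.range' (gMin j m p) (gMax j m p + 1 - gMin j m p)

/-- The vector `b(Γ_{j,m,1})`. -/
noncomputable def bVec (j : Idx) (m : ℕ) : List ℕ := (block j m 1).map b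

/-- The concatenated vector `[b(Γ_{3,m,1}), b(Γ_{2,m,1}), b(Γ_{1,m,1})]`. -/
noncomputable def bCat (m : ℕ) : List ℕ := bVec .three m ++ bVec .two m ++ bVec .one m

/-- `Σ b(Γ_{j,m,1})`. -/
noncomputable def bSum (j : Idx) (m : ℕ) : ℕ := (bVec j m).sum

/-- `Φ_m`. -/
noncomputable def Phi (m : ℕ) : ℕ := bSum .three m + bSum .two m + bSum .one m

/-- The partial block sum `Σ_{i = min Γ_{j,m,1}}^{n} b(i)`. -/
noncomputable def part (j : Idx) (m n : ℕ) : ℚ :=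
  ∑ i ∈ Finset.Icc (gMin j m 1) n, (b i : ℚ)

/-- The data `m`, `x = t_m`, `y = t_{m-1}`, `z = t_{m-2}` that the closed forms and
the algorithm work with. -/
structure Trip where
  m : ℕ
  x : ℤ
  y : ℤ
  z : ℤ

namespace Trip

/-- The data at level `m`, for `m ≥ 2`. -/
def ofLevel (m : ℕ) : Trip := ⟨m, t m, t (m - 1), t (m - 2)⟩

/-- From level `m` to level `m + 1`. -/
def up (s : Trip) : Trip := ⟨s.m + 1, s.x + s.y + s.z, s.x, s.y⟩

/-- From level `m` to level `m - 1`. -/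
def down (s : Trip) : Trip := ⟨s.m - 1, s.y, s.z, s.x - s.y - s.z⟩

/-! The thresholds; all divisions by `2` are exact. -/

def θ1 (s : Trip) : ℤ := (s.x + s.z - 1) / 2
def θ2 (s : Trip) : ℤ := (-5 * s.x + 10 * s.y + 3 * s.z - 1) / 2
def θ3 (s : Trip) : ℤ := (-s.x + 6 * s.y - 3 * s.z - 1) / 2
def η1 (s : Trip) : ℤ := -2 * s.x + 5 * s.y
def θ4 (s : Trip) : ℤ := (-s.x + 4 * s.y + s.z - 1) / 2
def θ5 (s : Trip) : ℤ := (3 * s.x - 5 * s.z - 1) / 2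
def η2 (s : Trip) : ℤ := 2 * s.y - s.z
def θ6 (s : Trip) : ℤ := (3 * s.x - 2 * s.y - s.z - 1) / 2
def θ7 (s : Trip) : ℤ := (s.x + 2 * s.y - s.z - 1) / 2
def θ8 (s : Trip) : ℤ := (s.x + 3 * s.z - 1) / 2
def θ9 (s : Trip) : ℤ := (-s.x + 4 * s.y + 3 * s.z - 1) / 2
def η3 (s : Trip) : ℤ := 2 * s.y
def θ10 (s : Trip) : ℤ := (s.x + 2 * s.y + s.z - 1) / 2

/-- The expression `(m/d) (a₁ x + a₂ y + a₃ z) + (1/e) (c₁ x + c₂ y + c₃ z)`. -/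
def form (s : Trip) (d a₁ a₂ a₃ e c₁ c₂ c₃ : ℚ) : ℚ :=
  (s.m : ℚ) / d * (a₁ * s.x + a₂ * s.y + a₃ * s.z) + 1 / e * (c₁ * s.x + c₂ * s.y + c₃ * s.z)

/-- The closed form of `Φ_m`. -/
def phiForm (s : Trip) : ℚ := s.form 22 (-5) 14 4 44 67 (-166) 5 + 1 / 4

/-- The closed form of `Σ b(Γ_{j,m,1})`. -/
def sumForm (s : Trip) : Idx → ℚ
  | .one => s.form 22 4 (-9) 10 44 19 36 (-169) - 1 / 4
  | .two => s.form 22 10 (-6) (-19) 44 (-189) 156 331 - 1 / 4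
  | .three => s.form 22 (-19) 29 13 44 237 (-358) (-157) + 3 / 4

/-- The closed form of `Σ_{j=4}^{m-1} Φ_j`. -/
def phiSumForm (s : Trip) : ℚ :=
  s.form 44 13 (-10) 5 (11 / 2) (-8) 8 (-7) + (s.m : ℚ) / 4 + 2

/-- The closed form of `B(max Γ_{j,m,1})`. -/
def maxForm (s : Trip) : Idx → ℚ
  | .one => s.form 44 3 18 13 44 3 (-102) (-51) + ((s.m : ℚ) + 9) / 4
  | .two => s.form 44 (-5) 36 (-7) 22 (-8) (-69) 59 + ((s.m : ℚ) + 10) / 4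
  | .three => s.form 44 (-25) 48 31 44 173 (-294) (-213) + ((s.m : ℚ) + 11) / 4

/-- The index `j` of the block of level `m` that contains `n`, for `θ1 ≤ n < θ10`. -/
def idx (s : Trip) (n : ℤ) : Idx :=
  if n < s.θ4 then .three else if n < s.θ7 then .two else .one

end Trip

/-! ### The algorithm

Every procedure returns its result and the number of search and reduction steps performed. One
step uses a bounded number of arithmetic operations and comparisons, and the data for level
`m ± 1` is obtained from that for level `m` by additions and subtractions. -/

/-- The initial values of `b` on the blocks `Γ_{3,4,1}`, `Γ_{2,4,1}`, `Γ_{1,4,1}`, `Γ_{3,5,1}`,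
`Γ_{2,5,1}`, `Γ_{3,6,1}`, which are `[8]`, `[9,10]`, `[11,…,14]`, `[15,16]`, `[17,…,20]`,
`[28,…,31]`. -/
def initB (n : ℤ) : ℤ :=
  if n ∈ [8, 10, 14, 15, 16, 19, 20, 28, 29, 30, 31] then 1 else 0

/-- The sum of the initial values at the positions `lo, …, n`. -/
def initSum (lo n : ℤ) : ℚ :=
  ((List.range (n + 1 - lo).toNat).map fun i => (initB (lo + i) : ℚ)).sum

/-- Search upwards for the level whose three blocks contain `n`, with at most `fuel` steps. -/
def search : ℕ → Trip → ℤ → Trip × ℕ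
  | 0, s, _ => (s, 0)
  | fuel + 1, s, n =>
    if n < s.θ10 then (s, 0)
    else
      let r := search fuel s.up n
      (r.1, r.2 + 1)

/-- The level `m ≥ 4` with `n` in one of the blocks `Γ_{j,m,1}`, for `n ≥ 8`. -/
def level (n : ℕ) : Trip × ℕ := search n ⟨4, 13, 7, 4⟩ n

/-- The value `b(n)` for `n` in the block `j` of the level `s`, by the recursive description. -/
def bBlock (j : Idx) (s : Trip) (n : ℤ) : ℤ × ℕ :=
  match j with
  | .one =>
    if s.m ≤ 4 then (initB n, 0)
    else
      let s' := s.down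
      let r := bBlock (s'.idx (n - s.y)) s' (n - s.y)
      (r.1 + (if s.η3 ≤ n then 1 else 0), r.2 + 1)
  | .two =>
    if s.m ≤ 5 then (initB n, 0)
    else
      let s' := s.down.down
      let r := bBlock (s'.idx (n - s.y)) s' (n - s.y)
      (r.1 + (if s.η2 ≤ n then 1 else 0), r.2 + 1)
  | .three =>
    if s.m ≤ 6 then (initB n, 0)
    else
      let s' := s.down.down.down
      let r := bBlock (s'.idx (n - s.y)) s' (n - s.y)
      (r.1 + (if n < s.η1 then 1 else 0), r.2 + 1)
termination_by s.m
decreasing_by all_goals (simp only [Trip.down]; omega)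

/-- The recursive computation of `b(n)`. -/
def bAlg (n : ℕ) : ℤ × ℕ :=
  if n ≤ 7 then (0, 0)
  else
    let s := level n
    let r := bBlock (s.1.idx n) s.1 n
    (r.1, s.2 + r.2)

/-- The recursive computation of the partial block sum `Σ_{i = min Γ_{j,m,1}}^{n} b(i)`
for `n` in the block `j` of the level `s`. -/
def partAlg (j : Idx) (s : Trip) (n : ℤ) : ℚ × ℕ :=
  match j with
  | .three =>
    if s.m ≤ 6 then (initSum s.θ1 n, 0)
    else
      let s' := s.down.down.down
      let n' := n - s.y
      if n < s.θ2 then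
        let r := partAlg .three s' n'
        (r.1 + n - s.θ1 + 1, r.2 + 1)
      else if n < s.θ3 then
        let r := partAlg .two s' n'
        (r.1 + s'.sumForm .three + n - s.θ1 + 1, r.2 + 1)
      else if n < s.η1 then
        let r := partAlg .one s' n'
        (r.1 + s'.sumForm .three + s'.sumForm .two + n - s.θ1 + 1, r.2 + 1)
      else
        let r := partAlg .one s' n'
        (r.1 + s'.sumForm .three + s'.sumForm .two
          + (-5 * (s.x : ℚ) + 10 * s.y - s.z + 1) / 2, r.2 + 1)
  | .two =>
    if s.m ≤ 5 then (initSum s.θ4 n, 0)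
    else
      let s' := s.down.down
      let n' := n - s.y
      if n < s.θ5 then
        let r := partAlg .three s' n'
        (r.1, r.2 + 1)
      else if n < s.η2 then
        let r := partAlg .two s' n'
        (r.1 + s'.sumForm .three, r.2 + 1)
      else if n < s.θ6 then
        let r := partAlg .two s' n'
        (r.1 + s'.sumForm .three + n - s.η2 + 1, r.2 + 1)
      else
        let r := partAlg .one s' n'
        (r.1 + s'.sumForm .three + s'.sumForm .two + n - s.η2 + 1, r.2 + 1)
  | .one =>
    if s.m ≤ 4 then (initSum s.θ7 n, 0)
    else
      let s' := s.down
      let n' := n - s.y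
      if n < s.θ8 then
        let r := partAlg .three s' n'
        (r.1, r.2 + 1)
      else if n < s.θ9 then
        let r := partAlg .two s' n'
        (r.1 + s'.sumForm .three, r.2 + 1)
      else if n < s.η3 then
        let r := partAlg .one s' n'
        (r.1 + s'.sumForm .three + s'.sumForm .two, r.2 + 1)
      else
        let r := partAlg .one s' n'
        (r.1 + s'.sumForm .three + s'.sumForm .two + n - s.η3 + 1, r.2 + 1)
termination_by s.m
decreasing_by all_goals (simp only [Trip.down]; omega)

/-- The closed form of `B(min Γ_{j,m,1} - 1)`: the greatest element of the preceding block
is `max Γ_{2,m,1}`, `max Γ_{3,m,1}`, `max Γ_{1,m-1,1}` for `j = 1, 2, 3`. -/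
def beforeForm (j : Idx) (s : Trip) : ℚ :=
  match j with
  | .one => s.maxForm .two
  | .two => s.maxForm .three
  | .three => s.down.maxForm .one

/-- The algorithm for `B(n)`. -/
def algB (n : ℕ) : ℚ × ℕ :=
  if n ≤ 51 then
    (∑ i ∈ Finset.Icc 1 n, ((bAlg i).1 : ℚ), ∑ i ∈ Finset.Icc 1 n, ((bAlg i).2 + 1))
  else
    let s := level n
    let j := s.1.idx n
    let r := partAlg j s.1 n
    (beforeForm j s.1 + r.1, s.2 + r.2)

end TribSq

namespace TribSq

/-! Write `σ` for the substitution and `D M` for the lengths 0, 1, 3, 7, 14, 27, 51, …. Every `σ(x)`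
begins with `a`, so agreement with a prefix gains one letter each time `σ` is applied. Hence,
whatever letter stands at `s`, the prefix of length `D M` occurs at `img^[M] s` (`agree_D`). A
letter at `s₀` therefore generates, under `σ^M`, a run whose period is the length of the image of
that letter and whose overlap is at least `D M`. The central fact is the converse,
`Match.exists_iterate`: by desubstitution, every repetition whose overlap is at least its period
minus one lies in such a run. It follows that there are no fourth powers, so a root never occurs
inside its own square. Counting square occurrences that end at `n` thus amounts to counting periods
(`b_eq_ncard_periods`).

With `m = r + 4`, the blocks of level `m` fill the interval from `D (r + 3) + 1` to `D (r + 4) = D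
(r + 3) + t (r + 3)`. The prefix of length `D (r + 3)` recurs at `t (r + 3)`, so squares that do not
begin in the first `t (r + 3)` letters are translates of squares ending at `n - t (r + 3)`. The
others have one of three periods, generated by the last letters of `T_{m-1} = σ^{r+3}(a) =
σ^{r+2}(ab) = σ^{r+1}(abac)` (`crossing_iff`): `t (r + 3)` from `a`, `t (r + 3) - t (r + 2)` from
`b`, `t r` from `c`. On each of the blocks `Γ₁`, `Γ₂`, `Γ₃` only one of these, respectively, is
possible, and it contributes on an initial or a final stretch. This is the recursion for `b`. The
kernel words enter only through the place of their first occurrence (`pos_kernel`) and through `k (r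
+ 4) = D r + 2`.

Summing the recursion over whole blocks gives `B (D (r + 4)) = 2 B (D (r + 3)) - B (D r) + 2 t r + D
r + 1`. The characteristic polynomial is `X⁴ - 2X³ + 1 = (X - 1)(X³ - X² - X - 1)`. The
inhomogeneous term is in resonance with both factors, which explains the terms `m · t` and `m / 4`
of the closed forms. Summing over part of a block gives the reductions, and exponential growth of
`t` bounds the number of levels by a multiple of `log n`. -/

/-- The Tribonacci sequence with positions numbered from `0`. -/
def u (i : ℕ) : Letter := trib (i + 1)

/-- The length of the image of the prefix of length `n` under the substitution. -/
def img : ℕ → ℕ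
  | 0 => 0
  | n + 1 => img n + (sub (u n)).length

/-- The prefix of length `n` of the Tribonacci sequence. -/
def pre (n : ℕ) : List Letter := (List.range n).map u

/-! ### Prefixes, images and desubstitution. -/

lemma length_pre (n : ℕ) : (pre n).length = n := by simp [pre]

lemma pre_succ (n : ℕ) : pre (n + 1) = pre n ++ [u n] := by simp [pre, List.range_succ]

lemma word_zero : word 0 = [Letter.a] := rfl

lemma word_succ (m : ℕ) : word (m + 1) = (word m).flatMap sub := by
  simp only [word, Function.iterate_succ_apply']

lemma flatMap_prefix {v w : List Letter} (h : v <+: w) : v.flatMap sub <+: w.flatMap sub := by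
  obtain ⟨r, rfl⟩ := h
  exact ⟨r.flatMap sub, by simp⟩

lemma word_prefix_succ (m : ℕ) : word m <+: word (m + 1) := by
  induction m with
  | zero => exact ⟨[Letter.b], rfl⟩
  | succ m ih =>
    rw [word_succ m, word_succ (m + 1)]
    exact flatMap_prefix ih

lemma word_prefix {m n : ℕ} (h : m ≤ n) : word m <+: word n := by
  induction n, h using Nat.le_induction with
  | base => exact List.prefix_refl _
  | succ n _ ih => exact ih.trans (word_prefix_succ n)

lemma length_flatMap_sub (w : List Letter) : w.length ≤ (w.flatMap sub).length := by
  induction w with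
  | nil => simp
  | cons l w ih =>
    rw [List.flatMap_cons, List.length_append]
    cases l <;> simp only [sub, List.length] <;> omega

lemma head_word (m : ℕ) : ∃ r, word m = Letter.a :: r := by
  obtain ⟨r, hr⟩ := word_prefix (Nat.zero_le m)
  exact ⟨r, by rw [← hr]; rfl⟩

lemma succ_le_length_word (m : ℕ) : m + 1 ≤ (word m).length := by
  induction m with
  | zero => simp [word_zero]
  | succ m ih =>
    obtain ⟨r, hr⟩ := head_word m
    have := length_flatMap_sub r
    rw [hr] at ih
    rw [word_succ, hr, List.flatMap_cons, List.length_append]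
    simp only [sub, List.length] at ih ⊢
    omega

/-- `u i` is read off in `word (i + 1)`; this word and `word m` are both prefixes of the longer of
the two. -/
lemma getElem?_word {m i : ℕ} (h : i < t m) : (word m)[i]? = some (u i) := by
  have h1 : i < (word (i + 1)).length := by have := succ_le_length_word (i + 1); omega
  have h2 : i < (word (max m (i + 1))).length :=
    lt_of_lt_of_le h (word_prefix (le_max_left _ _)).length_le
  have h0 : i < (word m).length := h
  have e1 := (word_prefix (le_max_left m (i + 1))).getElem (i := i) h0
  have e2 := (word_prefix (le_max_right m (i + 1))).getElem (i := i) h1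
  rw [List.getElem?_eq_getElem h0, e1, ← e2]
  simp [u, trib, List.getD_eq_getElem?_getD, List.getElem?_eq_getElem h1]

lemma word_eq_pre (m : ℕ) : word m = pre (t m) := by
  apply List.ext_getElem?
  intro i
  by_cases h : i < t m
  · rw [getElem?_word h]
    simp [pre, h]
  · rw [List.getElem?_eq_none (by simpa [t] using h),
      List.getElem?_eq_none (by simpa [length_pre] using h)]

lemma pre_prefix {m n : ℕ} (h : m ≤ n) : pre m <+: pre n := by
  induction n, h using Nat.le_induction with
  | base => exact List.prefix_refl _
  | succ n _ ih => exact ih.trans ⟨[u n], (pre_succ n).symm⟩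

lemma length_flatMap_pre (n : ℕ) : ((pre n).flatMap sub).length = img n := by
  induction n with
  | zero => rfl
  | succ n ih => rw [pre_succ, List.flatMap_append, List.length_append, ih]; simp [img]

lemma eq_pre_of_prefix {w : List Letter} {n : ℕ} (h : w <+: pre n) : w = pre w.length := by
  have hl : w.length ≤ n := by simpa [length_pre] using h.length_le
  exact (List.prefix_of_prefix_length_le h (pre_prefix hl) (by simp [length_pre])).eq_of_length
    (by simp [length_pre])

/-- The prefix lies in some `T_n`, whose image is `T_{n+1}`, again a prefix of the sequence. -/
lemma flatMap_pre (n : ℕ) : (pre n).flatMap sub = pre (img n) := by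
  have h1 : n ≤ t n := by have := succ_le_length_word n; unfold t; omega
  have h2 := flatMap_prefix (pre_prefix h1)
  rw [← word_eq_pre, ← word_succ, word_eq_pre] at h2
  rw [← length_flatMap_pre]
  exact eq_pre_of_prefix h2

/-- The fixed-point property letter by letter: appending `u n` to a prefix appends `sub (u n)` to
its image, which is itself a prefix. -/
lemma u_img_add (n j : ℕ) (h : j < (sub (u n)).length) :
    (sub (u n))[j]? = some (u (img n + j)) := by
  have h1 : pre (img n) ++ sub (u n) = pre (img (n + 1)) := by
    rw [← flatMap_pre, ← flatMap_pre, pre_succ]; simp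
  have h2 := congrArg (fun w => w[img n + j]?) h1
  beta_reduce at h2
  rw [List.getElem?_append_right (by simp [length_pre])] at h2
  simp only [length_pre, Nat.add_sub_cancel_left] at h2
  rw [h2]
  have : img n + j < img (n + 1) := by simp [img, h]
  simp [pre, this]

/-- Every image of a letter begins with `a`. -/
lemma u_img (n : ℕ) : u (img n) = .a := by
  have := u_img_add n 0 (by cases u n <;> simp [sub])
  cases h : u n <;> simp_all [sub]

lemma u_img_a {n : ℕ} (h : u n = .a) : u (img n + 1) = .b := by
  have := u_img_add n 1 (by simp [h, sub])
  simp_all [sub]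

lemma u_img_b {n : ℕ} (h : u n = .b) : u (img n + 1) = .c := by
  have := u_img_add n 1 (by simp [h, sub])
  simp_all [sub]

lemma img_a {n : ℕ} (h : u n = .a) : img (n + 1) = img n + 2 := by simp [img, h, sub]
lemma img_b {n : ℕ} (h : u n = .b) : img (n + 1) = img n + 2 := by simp [img, h, sub]
lemma img_c {n : ℕ} (h : u n = .c) : img (n + 1) = img n + 1 := by simp [img, h, sub]

lemma u_img_c {n : ℕ} (h : u n = .c) : u (img n + 1) = .a := by
  rw [← img_c h, u_img]

lemma u_zero : u 0 = .a := u_img 0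

lemma img_lt_succ (n : ℕ) : img n < img (n + 1) := by
  cases h : u n
  · rw [img_a h]; omega
  · rw [img_b h]; omega
  · rw [img_c h]; omega

lemma img_strictMono : StrictMono img := strictMono_nat_of_lt_succ img_lt_succ

lemma img_iterate_strictMono (M : ℕ) : StrictMono (img^[M]) := img_strictMono.iterate M

/-- The next letter decides the letter below. -/
lemma eq_of_u_img_succ {m n : ℕ} (h : u (img m + 1) = u (img n + 1)) : u m = u n := by
  cases hm : u m <;> cases hn : u n <;> first | rfl | (exfalso)
  all_goals
    first | rw [u_img_a hm] at h | rw [u_img_b hm] at h | rw [u_img_c hm] at h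
    first | rw [u_img_a hn] at h | rw [u_img_b hn] at h | rw [u_img_c hn] at h
    cases h

lemma img_succ_sub {m n : ℕ} (h : u m = u n) : img (m + 1) + img n = img (n + 1) + img m := by
  simp only [img, h]; omega

/-- The positions of `a` are exactly the beginnings of images. -/
lemma exists_img_of_u_eq_a {i : ℕ} (h : u i = .a) : ∃ n, i = img n := by
  have key : ∀ N, i < img N → ∃ n, i = img n := by
    intro N
    induction N with
    | zero => simp [img]
    | succ N ih =>
      intro hi
      by_cases h1 : i < img N
      · exact ih h1
      · by_cases h2 : i = img N
        · exact ⟨N, h2⟩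
        · exfalso
          cases hN : u N
          · rw [img_a hN] at hi
            obtain rfl : i = img N + 1 := by omega
            rw [u_img_a hN] at h; cases h
          · rw [img_b hN] at hi
            obtain rfl : i = img N + 1 := by omega
            rw [u_img_b hN] at h; cases h
          · rw [img_c hN] at hi; omega
  exact key (i + 1) (lt_of_lt_of_le (Nat.lt_succ_self i) (img_strictMono.le_apply))

/-- A letter other than `a` is the second letter of an image. -/
lemma exists_img_of_u_ne_a {i : ℕ} (h : u i ≠ .a) :
    ∃ n, i = img n + 1 ∧ i + 1 = img (n + 1) := by
  have key : ∀ N, i < img N → ∃ n, i = img n + 1 ∧ i + 1 = img (n + 1) := by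
    intro N
    induction N with
    | zero => simp [img]
    | succ N ih =>
      intro hi
      by_cases h1 : i < img N
      · exact ih h1
      · have h2 : i ≠ img N := fun h2 => h (h2 ▸ u_img N)
        refine ⟨N, ?_⟩
        cases hN : u N
        · rw [img_a hN] at hi ⊢; omega
        · rw [img_b hN] at hi ⊢; omega
        · rw [img_c hN] at hi; omega
  exact key (i + 1) (lt_of_lt_of_le (Nat.lt_succ_self i) (img_strictMono.le_apply))

lemma u_succ_of_ne_a {i : ℕ} (h : u i ≠ .a) : u (i + 1) = .a := by
  obtain ⟨n, -, hn⟩ := exists_img_of_u_ne_a h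
  rw [hn, u_img]

lemma u_pred_of_ne_a {i : ℕ} (h : u (i + 1) ≠ .a) : u i = .a := by
  by_contra h1
  exact h (u_succ_of_ne_a h1)

/-- Two consecutive letters have an image of length at least `3`. -/
lemma img_add_two (n : ℕ) : img n + 3 ≤ img (n + 2) := by
  have h1 : img (n + 1) < img (n + 2) := img_lt_succ (n + 1)
  have h0 := img_lt_succ n
  cases h : u n
  · rw [img_a h] at *; omega
  · rw [img_b h] at *; omega
  · have := u_succ_of_ne_a (i := n) (by rw [h]; simp)
    have e : img (n + 2) = img (n + 1) + 2 := img_a this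
    omega

lemma img_add_le (n i : ℕ) : img n + i ≤ img (n + i) := by
  induction i with
  | zero => simp
  | succ i ih => have := img_lt_succ (n + i); rw [← add_assoc n i 1]; omega

/-! ### Iterated images -/

/-- Positions with the same continuation of length `n` have images of the same length. -/
lemma img_add_of_agree {p n : ℕ} (h : ∀ i < n, u (p + i) = u i) : img (p + n) = img p + img n := by
  induction n with
  | zero => simp [img]
  | succ n ih =>
    have e := img_succ_sub (h n (Nat.lt_succ_self n))
    have := ih fun i hi => h i (by omega)
    rw [← add_assoc p n 1]
    omega

/-- The extra letter beyond `img n` is the initial `a` of the next image, which is there whatever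
the next letter is. -/
lemma agree_img {p n : ℕ} (h : ∀ i < n, u (p + i) = u i) :
    ∀ i < img n + 1, u (img p + i) = u i := by
  induction n with
  | zero => intro i hi; obtain rfl : i = 0 := by simpa [img] using hi
            rw [add_zero, u_img, u_zero]
  | succ n ih =>
    intro i hi
    have h' : ∀ i < n, u (p + i) = u i := fun i hi => h i (by omega)
    have hn := h n (Nat.lt_succ_self n)
    have e := img_add_of_agree h'
    have e' := img_add_of_agree h
    by_cases h1 : i < img n + 1
    · exact ih h' i h1
    · by_cases h2 : i = img (n + 1)
      · rw [h2, ← e', u_img, u_img]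
      -- What is left is the second letter of the image of the last agreeing letter; the image of
      -- `c` has none.
      · have h3 : i = img n + 1 ∧ u n ≠ .c := by
          cases hu : u n
          · rw [img_a hu] at *; simp; omega
          · rw [img_b hu] at *; simp; omega
          · rw [img_c hu] at *; omega
        rw [h3.1, ← add_assoc, ← e]
        cases hu : u n
        · rw [u_img_a hu, u_img_a (hn.trans hu)]
        · rw [u_img_b hu, u_img_b (hn.trans hu)]
        · exact absurd hu h3.2

lemma iterate_agree_img {p n : ℕ} (h : ∀ i < n, u (p + i) = u i) (M : ℕ) :
    (∀ i < img^[M] n, u (img^[M] p + i) = u i) ∧ img^[M] (p + n) = img^[M] p + img^[M] n := by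
  induction M with
  | zero => exact ⟨h, rfl⟩
  | succ M ih =>
    simp only [Function.iterate_succ_apply']
    refine ⟨fun i hi => agree_img ih.1 i (by omega), ?_⟩
    rw [ih.2, img_add_of_agree ih.1]

lemma t_eq_iterate (m : ℕ) : t m = img^[m] 1 := by
  induction m with
  | zero => rfl
  | succ m ih =>
    rw [Function.iterate_succ_apply', ← ih, t, word_succ, word_eq_pre, length_flatMap_pre]

lemma iterate_img_zero (m : ℕ) : img^[m] 0 = 0 := Function.iterate_fixed rfl m

lemma img_one : img 1 = 2 := img_a u_zero
lemma u_one : u 1 = .b := u_img_a u_zero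
lemma img_two : img 2 = 4 := by rw [img_b u_one, img_one]
lemma u_two : u 2 = .a := img_one ▸ u_img 1
lemma u_three : u 3 = .c := by have := u_img_b u_one; rwa [img_one] at this
lemma img_three : img 3 = 6 := by rw [img_a u_two, img_two]
lemma img_four : img 4 = 7 := by rw [img_c u_three, img_three]
lemma u_four : u 4 = .a := img_two ▸ u_img 2
lemma u_five : u 5 = .b := by have := u_img_a u_two; rwa [img_two] at this
lemma u_six : u 6 = .a := img_three ▸ u_img 3

lemma iterate_img_two (m : ℕ) : img^[m] 2 = t (m + 1) := by
  rw [t_eq_iterate, Function.iterate_succ_apply, img_one]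

lemma iterate_img_four (m : ℕ) : img^[m] 4 = t (m + 2) := by
  rw [t_eq_iterate, Function.iterate_succ_apply, Function.iterate_succ_apply, img_one, img_two]

/-- The prefix of length 3 is `ab·a`: its last letter repeats the first. -/
lemma iterate_img_three (m : ℕ) : img^[m] 3 = t (m + 1) + t m := by
  rw [← iterate_img_two, t_eq_iterate]
  refine (iterate_agree_img (p := 2) (n := 1) ?_ m).2
  intro i hi
  obtain rfl : i = 0 := by omega
  rw [u_two, u_zero]

/-- `T_3 = abac·aba`: after the first four letters the prefix of length 3 recurs, and `σ^m`
preserves this decomposition. -/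
lemma t_add_three (m : ℕ) : t (m + 3) = t (m + 2) + t (m + 1) + t m := by
  have h : t (m + 3) = img^[m] 7 := by
    rw [t_eq_iterate, Function.iterate_add_apply img m 3]
    simp only [Function.iterate_succ_apply, Function.iterate_zero_apply, img_one, img_two, img_four]
  rw [h, ← iterate_img_four, add_assoc, ← iterate_img_three]
  refine (iterate_agree_img (p := 4) (n := 3) ?_ m).2
  intro i hi
  interval_cases i
  · rw [u_four, u_zero]
  · rw [u_five, u_one]
  · rw [u_six, u_two]

lemma t_zero : t 0 = 1 := rfl
lemma t_one : t 1 = 2 := rfl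
lemma t_two : t 2 = 4 := rfl

lemma t_pos (m : ℕ) : 0 < t m := by have := succ_le_length_word m; unfold t; omega

lemma t_lt_succ (m : ℕ) : t m < t (m + 1) := by
  rw [t_eq_iterate, ← iterate_img_two]
  exact img_iterate_strictMono m (by norm_num)

lemma t_strictMono : StrictMono t := strictMono_nat_of_lt_succ t_lt_succ

/-- The lengths `0, 1, 3, 7, 14, …` of the palindromic prefixes. -/
def D : ℕ → ℕ
  | 0 => 0
  | M + 1 => img (D M) + 1

/-- Whatever the letter at `s`, its `M`-th image begins a copy of the prefix of length `D M`. -/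
lemma agree_D (M s : ℕ) : ∀ i < D M, u (img^[M] s + i) = u i := by
  induction M with
  | zero => simp [D]
  | succ M ih => rw [Function.iterate_succ_apply']; exact agree_img ih

/-- The prefix of length `D M` recurs at `t M`, so the image of the prefix of length `t M + D M`
splits into two images of known length, and induction applies. -/
lemma D_succ (M : ℕ) : D (M + 1) = D M + t M := by
  induction M with
  | zero => rfl
  | succ M ih =>
    have h := img_add_of_agree (agree_D M 1)
    rw [← t_eq_iterate, add_comm, ← ih] at h
    have h' : img (t M) = t (M + 1) := by
      rw [t_eq_iterate, t_eq_iterate, Function.iterate_succ_apply']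
    rw [D, h, h', D]; omega

/-- Expresses the ends of the levels through `t`. It also shows that the halves in the thresholds
are integers. -/
lemma D_closed (M : ℕ) : 2 * D (M + 1) + 3 = t (M + 2) + t M := by
  induction M with
  | zero => rfl
  | succ M ih => rw [D_succ (M + 1), t_add_three]; omega

lemma D_add_three (M : ℕ) : D (M + 3) = D M + t (M + 3) := by
  rw [D_succ, D_succ, D_succ, t_add_three]; omega

/-! ### Arithmetic of `t`, `D` and `k` -/

lemma t_add_two_ge (r : ℕ) : t (r + 1) + t r ≤ t (r + 2) := by
  cases r with
  | zero => decide
  | succ r => have : t (r + 1 + 2) = t (r + 1 + 1) + t (r + 1) + t r := t_add_three r; omega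

lemma D_lt_t_succ (r : ℕ) : D r < t (r + 1) := by
  induction r with
  | zero => decide
  | succ r ih => have : t (r + 1) + t r ≤ t (r + 1 + 1) := t_add_two_ge r; rw [D_succ]; omega

lemma t_le_D_succ (r : ℕ) : t r ≤ D r + 1 := by
  induction r using Nat.strong_induction_on with
  | _ r ih =>
    match r with
    | 0 => decide
    | 1 => decide
    | 2 => decide
    | r + 3 => have := D_add_three r; omega

lemma D_strictMono : StrictMono D :=
  strictMono_nat_of_lt_succ fun n => by have := t_pos n; rw [D_succ]; omega

/-- So a kernel word is one letter followed by a prefix just one letter longer than `D r`, the part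
that always recurs under `σ^r`. -/
lemma k_eq (r : ℕ) : k (r + 4) = D r + 2 := by
  induction r using Nat.strong_induction_on with
  | _ r ih =>
    match r with
    | 0 => rfl
    | 1 => rfl
    | 2 => rfl
    | r + 3 =>
      have h : k (r + 3 + 4) = k (r + 2 + 4) + k (r + 1 + 4) + k (r + 4) - 1 := rfl
      rw [h, ih _ (by omega), ih _ (by omega), ih _ (by omega)]
      have h1 := D_add_three r
      have h2 := D_succ r
      have h3 : D (r + 2) = D (r + 1) + t (r + 1) := D_succ (r + 1)
      have h4 := D_closed r
      have h5 := t_add_three r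
      omega

/-! ### Repetitions -/

/-- The factors of length `q` beginning at `s` and at `s + l` agree. -/
def Match (s l q : ℕ) : Prop := ∀ i < q, u (s + i) = u (s + l + i)

/-- Equal factors have images of equal length, stated without subtraction. -/
lemma img_add_of_match {p q n : ℕ} (h : ∀ i < n, u (p + i) = u (q + i)) :
    img (p + n) + img q = img (q + n) + img p := by
  induction n with
  | zero => simp [add_comm]
  | succ n ih =>
    have e := img_succ_sub (h n (Nat.lt_succ_self n))
    have := ih fun i hi => h i (by omega)
    rw [← add_assoc p n 1, ← add_assoc q n 1]
    omega

/-- Agreement of images implies agreement of the letters below. -/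
lemma agree_of_img {p q L : ℕ} (h : ∀ i < L, u (img p + i) = u (img q + i)) (n : ℕ) :
    img (p + n) + 1 < img p + L → u (p + n) = u (q + n) := by
  induction n using Nat.strong_induction_on with
  | _ n ih =>
    intro hn
    have h0 : ∀ i < n, u (p + i) = u (q + i) := fun i hi => ih i hi <| by
      have := img_strictMono (show p + i < p + n by omega)
      omega
    have e := img_add_of_match h0
    have hp := img_strictMono.monotone (show p ≤ p + n by omega)
    apply eq_of_u_img_succ
    have := h (img (p + n) - img p + 1) (by omega)
    rw [show img p + (img (p + n) - img p + 1) = img (p + n) + 1 by omega,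
      show img q + (img (p + n) - img p + 1) = img (q + n) + 1 by omega] at this
    exact this

/-- A repetition can be extended so that it starts and ends with the letter `a`. -/
lemma Match.exists_extend {s l q : ℕ} (h : Match s l q) (hq : 1 ≤ q) :
    ∃ s₁ r, s₁ ≤ s ∧ s + q ≤ s₁ + r + 1 ∧ Match s₁ l (r + 1) ∧ u s₁ = .a ∧ u (s₁ + r) = .a := by
  have left : ∃ s₁ r, s₁ ≤ s ∧ s + q = s₁ + r + 1 ∧ Match s₁ l (r + 1) ∧ u s₁ = .a := by
    by_cases hs : u s = .a
    · exact ⟨s, q - 1, le_rfl, by omega, by rwa [Nat.sub_add_cancel hq], hs⟩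
    · obtain _ | s := s
      · exact absurd u_zero hs
      have h0 := h 0 (by omega)
      rw [add_zero, add_zero] at h0
      have ha : u s = .a := u_pred_of_ne_a hs
      have hb : u (s + l) = .a := u_pred_of_ne_a (by
        rw [show s + l + 1 = s + 1 + l by omega, ← h0]; exact hs)
      refine ⟨s, q, by omega, by omega, ?_, ha⟩
      intro i hi
      obtain _ | i := i
      · simp [ha, hb]
      · have := h i (by omega)
        rwa [show s + (i + 1) = s + 1 + i by omega, show s + l + (i + 1) = s + 1 + l + i by omega]
  obtain ⟨s₁, r, h1, h2, h3, h4⟩ := left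
  by_cases hr : u (s₁ + r) = .a
  · exact ⟨s₁, r, h1, by omega, h3, h4, hr⟩
  · have e := h3 r (by omega)
    have ha := u_succ_of_ne_a hr
    have hb : u (s₁ + l + r + 1) = .a := u_succ_of_ne_a (by rwa [← e])
    refine ⟨s₁, r + 1, h1, by omega, ?_, h4, ha⟩
    intro i hi
    by_cases hi' : i = r + 1
    · subst hi'
      rw [← add_assoc, ← add_assoc, ha, hb]
    · exact h3 i (by omega)

/-- Both ends of the `M`-th image of the letter at `s₀` are followed by the prefix of length `D M`.
Comparing the two copies gives the run. -/
lemma match_of_iterate {M s₀ s l q : ℕ} (hl : img^[M] s₀ + l = img^[M] (s₀ + 1))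
    (hs : img^[M] s₀ ≤ s) (hq : s + q ≤ img^[M] s₀ + D M) : Match s l q := by
  intro i hi
  have h1 := agree_D M s₀ (s + i - img^[M] s₀) (by omega)
  have h2 := agree_D M (s₀ + 1) (s + i - img^[M] s₀) (by omega)
  rw [← h2] at h1
  rwa [show img^[M] s₀ + (s + i - img^[M] s₀) = s + i by omega,
    show img^[M] (s₀ + 1) + (s + i - img^[M] s₀) = s + l + i by omega] at h1

/-- Every repetition of exponent almost `2` lies in the repetition that is generated by
a single letter under some iterate of the substitution. -/
theorem Match.exists_iterate {s l q : ℕ} (h : Match s l q) (hl : 1 ≤ l) (hq : l ≤ q + 1) :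
    ∃ M s₀, img^[M] s₀ + l = img^[M] (s₀ + 1) ∧ img^[M] s₀ ≤ s ∧ s + q ≤ img^[M] s₀ + D M := by
  induction l using Nat.strong_induction_on generalizing s q with
  | _ l ih =>
    by_cases hl1 : l = 1
    · subst hl1
      obtain _ | q := q
      · exact ⟨0, s, rfl, le_rfl, by simp [D]⟩
      have h0 := h 0 (by omega)
      rw [add_zero, add_zero] at h0
      have ha : u s = .a := by
        by_contra hne
        exact hne (h0.trans (u_succ_of_ne_a hne))
      obtain ⟨s', rfl⟩ := exists_img_of_u_eq_a ha
      -- Of the three images only that of `c` has length 1, so only `c` puts two letters `a` next to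
      -- each other.
      have hc : u s' = .c := by
        rw [ha] at h0
        cases hu : u s'
        · rw [u_img_a hu] at h0; cases h0
        · rw [u_img_b hu] at h0; cases h0
        · rfl
      -- The letter after `c` is `a`, with image `ab`, so `aaa` does not occur and the run stops
      -- here.
      have hq0 : q = 0 := by
        by_contra hq0
        have h1 := h 1 (by omega)
        rw [← h0, ha, ← img_c hc] at h1
        have hd := u_succ_of_ne_a (i := s') (by rw [hc]; simp)
        rw [u_img_a hd] at h1
        cases h1
      subst hq0
      exact ⟨1, s', (img_c hc).symm, le_rfl, le_rfl⟩
    · obtain ⟨s₁, r, h1, h2, h3, ha, hb⟩ := h.exists_extend (by omega)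
      have ha' : u (s₁ + l) = .a := by
        have := h3 0 (by omega)
        rw [add_zero, add_zero] at this
        rw [← this, ha]
      obtain ⟨s', rfl⟩ := exists_img_of_u_eq_a ha
      obtain ⟨p', hp'⟩ := exists_img_of_u_eq_a ha'
      obtain ⟨e', he'⟩ := exists_img_of_u_eq_a hb
      have hsp : s' < p' := img_strictMono.lt_iff_lt.1 (by omega)
      have hse : s' ≤ e' := img_strictMono.le_iff_le.1 (by omega)
      obtain ⟨l', rfl⟩ := Nat.exists_eq_add_of_lt hsp
      obtain ⟨q', rfl⟩ := Nat.exists_eq_add_of_le hse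
      rw [add_assoc] at hp'
      -- The period strictly decreases on desubstitution: two adjacent letters already have an image
      -- of length at least 3.
      have hl' : l' + 1 < l := by
        obtain _ | l' := l'
        · omega
        · have e1 := img_add_two s'
          have e2 := img_add_le (s' + 2) l'
          rw [show s' + 2 + l' = s' + (l' + 1 + 1) by omega] at e2
          omega
      -- The final matched `a`, at `s₁ + r`, starts the image of letter `s' + q'`, so all earlier
      -- images are matched completely.
      have hm : Match s' (l' + 1) q' := by
        intro i hi
        refine agree_of_img (L := r + 1) ?_ i ?_
        · intro j hj
          rw [← hp']
          exact h3 j hj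
        · have := img_strictMono (show s' + i < s' + q' by omega)
          omega
      -- The slack of one is inherited. Otherwise two whole letters would separate the end of the
      -- overlap from the end of the period, and their image would force `l ≥ r + 3`, while `l ≤ q +
      -- 1 ≤ r + 2`.
      have hq' : l' + 1 ≤ q' + 1 := by
        by_contra hlt
        have e1 := img_add_two (s' + q')
        have e2 := img_strictMono.monotone (show s' + q' + 2 ≤ s' + (l' + 1) by omega)
        omega
      obtain ⟨M, s₀, i1, i2, i3⟩ := ih (l' + 1) hl' hm (by omega) hq'
      have hD := img_add_of_agree (agree_D M s₀)
      have hM : Match (img^[M] s₀) (l' + 1) (s' - img^[M] s₀) :=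
        match_of_iterate i1 le_rfl (by omega)
      -- The period of the generating run is mapped to `l`: moving its start from `s'` back to
      -- `img^[M] s₀` does not change the length of the image, as the letters passed over match.
      have e := img_add_of_match hM
      rw [show img^[M] s₀ + (s' - img^[M] s₀) = s' by omega,
        show img^[M] s₀ + (l' + 1) + (s' - img^[M] s₀) = s' + (l' + 1) by omega, i1] at e
      refine ⟨M + 1, s₀, ?_, ?_, ?_⟩ <;> simp only [Function.iterate_succ_apply', D]
      · omega
      · exact (img_strictMono.monotone i2).trans h1
      · have := img_strictMono.monotone i3
        omega

/-- The image of any letter begins with `a`, so its `(M + 1)`-st iterate contains a copy of `T_M`.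
-/
lemma iterate_succ_ge (M s : ℕ) : img^[M + 1] s + t M ≤ img^[M + 1] (s + 1) := by
  simp only [Function.iterate_succ_apply]
  have h := (iterate_agree_img (p := img s) (n := 1) (fun i hi => by
    obtain rfl : i = 0 := by omega
    rw [add_zero, u_img, u_zero]) M).2
  rw [← t_eq_iterate] at h
  rw [← h]
  exact (img_iterate_strictMono M).monotone (img_lt_succ s)

/-- There are no fourth powers. -/
lemma not_match_three_mul {s l : ℕ} (hl : 1 ≤ l) : ¬ Match s l (3 * l) := by
  intro h
  obtain ⟨M, s₀, h1, h2, h3⟩ := h.exists_iterate hl (by omega)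
  obtain _ | M := M
  · simp only [D] at h3; omega
  · have e1 := iterate_succ_ge M s₀
    have e2 := D_succ M
    have e3 := D_lt_t_succ M
    -- With `l ≥ t M` this gives `D (M + 1) = D M + t M < t (M + 1) + t M ≤ 3 l`, too short an
    -- overlap for a fourth power.
    have e4 : t (M + 1) ≤ 2 * t M := by
      rw [t_eq_iterate, t_eq_iterate, Function.iterate_succ_apply']
      generalize img^[M] 1 = n
      induction n with
      | zero => simp [img]
      | succ n ih =>
        have : img (n + 1) ≤ img n + 2 := by
          cases hu : u n
          · rw [img_a hu]
          · rw [img_b hu]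
          · rw [img_c hu]; omega
        omega
    omega

/-- A square root does not occur inside its square. -/
lemma not_match_inside {s l j : ℕ} (h : Match s l l) (hj : 0 < j) (hjl : j < l) :
    ¬ Match s j l := by
  -- Shifts by `j` and by `l` combine to a period `j` on a stretch of length at least `4 j`, a
  -- fourth power. A shift with `2 j > l` is replaced by the complementary shift `l - j`.
  have key : ∀ j, 0 < j → 2 * j ≤ l → ¬ Match s j l := by
    intro j hj hjl hm
    refine not_match_three_mul (s := s) hj fun i hi => ?_
    by_cases hil : i < l
    · exact hm i hil
    · have e1 := h (i - l) (by omega)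
      have e2 := hm (i - l) (by omega)
      have e3 := h (i - l + j) (by omega)
      rw [show s + l + (i - l) = s + i by omega] at e1
      rw [← e1, e2, show s + j + (i - l) = s + (i - l + j) by omega, e3]
      congr 1; omega
  intro hm
  by_cases h2 : 2 * j ≤ l
  · exact key j hj h2 hm
  · refine key (l - j) (by omega) (by omega) fun i hi => ?_
    by_cases hij : i < j
    · have e1 := hm (l - j + i) (by omega)
      rw [h i hi, show s + (l - j) + i = s + (l - j + i) by omega, e1]
      congr 1; omega
    · have e1 := hm (i - j) (by omega)
      have e2 := h (i - j) (by omega)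
      rw [show s + j + (i - j) = s + i by omega] at e1
      rw [← e1, e2]
      congr 1; omega

/-! ### Occurrences and squares -/

/-- The factor of length `l` beginning at the position `s` (numbered from `0`). -/
def seg (s l : ℕ) : List Letter := (List.range l).map fun i => u (s + i)

lemma length_seg (s l : ℕ) : (seg s l).length = l := by simp [seg]

lemma seg_eq_iff {s s' l : ℕ} : seg s l = seg s' l ↔ ∀ i < l, u (s + i) = u (s' + i) := by
  simp [seg]

lemma endsAt_iff {w : List Letter} {n : ℕ} :
    EndsAt w n ↔ w.length ≤ n ∧ seg (n - w.length) w.length = w := by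
  unfold EndsAt
  refine and_congr_right fun h => ?_
  have : factor (n - w.length + 1) n = seg (n - w.length) w.length := by
    rw [factor, seg, show n + 1 - (n - w.length + 1) = w.length by omega, List.range'_eq_map_range,
      List.map_map]
    refine List.map_congr_left fun i _ => ?_
    simp only [Function.comp, u]
    congr 1; omega
  rw [this]

lemma finite_occ (w : List Letter) (n : ℕ) : {i : ℕ | i ≤ n ∧ EndsAt w i}.Finite :=
  (Set.finite_Iic n).subset fun _ h => h.1

lemma IsOcc.unique {w : List Letter} {p n n' : ℕ} (h : IsOcc w p n) (h' : IsOcc w p n') :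
    n = n' := by
  have key : ∀ {n n' : ℕ}, IsOcc w p n → IsOcc w p n' → ¬ n < n' := by
    intro n n' h h' hlt
    have : {i : ℕ | i ≤ n ∧ EndsAt w i}.ncard < {i : ℕ | i ≤ n' ∧ EndsAt w i}.ncard := by
      refine Set.ncard_lt_ncard ⟨fun i hi => ⟨hi.1.trans hlt.le, hi.2⟩, fun hsub => ?_⟩
        (finite_occ w n')
      exact absurd (hsub ⟨le_rfl, h'.1⟩).1 (by omega)
    rw [h.2, h'.2] at this
    omega
  exact le_antisymm (not_lt.1 (key h' h)) (not_lt.1 (key h h'))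

/-- The periods of the squares that end at position `n`. -/
def periods (n : ℕ) : Set ℕ := {l | 1 ≤ l ∧ 2 * l ≤ n ∧ Match (n - 2 * l) l l}

lemma finite_periods (n : ℕ) : (periods n).Finite :=
  (Set.finite_Iic n).subset fun l h => by have := h.2.1; simp; omega

lemma SquareAt.length_mem {w : List Letter} {p n : ℕ} (h : SquareAt w p n) :
    w.length ∈ periods n := by
  obtain ⟨hw, e, h1, h2, rfl⟩ := h
  have e1 := endsAt_iff.1 h1.1
  have e2 := endsAt_iff.1 h2.1
  have hl : 1 ≤ w.length := List.length_pos_iff.2 hw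
  refine ⟨hl, by omega, ?_⟩
  have := seg_eq_iff.1 (e1.2.trans e2.2.symm)
  intro i hi
  rw [show e + w.length - 2 * w.length = e - w.length by omega,
    show e - w.length + w.length = e + w.length - w.length by omega]
  exact this i hi

lemma exists_squareAt {l n : ℕ} (h : l ∈ periods n) :
    ∃ p, SquareAt (seg (n - l) l) p n := by
  obtain ⟨h1, h2, h3⟩ := h
  set w := seg (n - l) l with hw
  have hwl : w.length = l := length_seg _ _
  have o2 : EndsAt w n := endsAt_iff.2 ⟨by omega, by rw [hwl]⟩
  have o1 : EndsAt w (n - l) := endsAt_iff.2 ⟨by omega, by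
    rw [hwl, hw, seg_eq_iff]
    intro i hi
    have := h3 i hi
    rwa [show n - 2 * l = n - l - l by omega, show n - l - l + l = n - l by omega] at this⟩
  -- The index is the number of occurrences up to the end of the first half. No occurrence ends
  -- strictly between the two halves' ends, since it would lie inside the square, so the second half
  -- is the next occurrence.
  refine ⟨{i : ℕ | i ≤ n - l ∧ EndsAt w i}.ncard, ?_, n - l, ⟨o1, rfl⟩, ⟨?_, ?_⟩, by omega⟩
  · rw [← List.length_pos_iff]; omega
  · rwa [hwl, Nat.sub_add_cancel (by omega)]
  · rw [hwl, Nat.sub_add_cancel (by omega)]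
    have : {i : ℕ | i ≤ n ∧ EndsAt w i} = insert n {i : ℕ | i ≤ n - l ∧ EndsAt w i} := by
      ext i
      simp only [Set.mem_ofPred_eq, Set.mem_insert_iff]
      constructor
      · rintro ⟨hi, ho⟩
        by_cases hin : i = n
        · exact Or.inl hin
        · refine Or.inr ⟨?_, ho⟩
          by_contra hlt
          have e := endsAt_iff.1 ho
          rw [hwl, ← (endsAt_iff.1 o1).2, hwl, seg_eq_iff] at e
          refine not_match_inside (j := i - (n - l)) h3 (by omega) (by omega) fun a ha => ?_
          have := e.2 a ha
          rw [show n - 2 * l = n - l - l by omega, ← this]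
          congr 1; omega
      · rintro (rfl | ⟨hi, ho⟩)
        · exact ⟨le_rfl, o2⟩
        · exact ⟨by omega, ho⟩
    rw [this, Set.ncard_insert_of_notMem (by simp; omega) (finite_occ _ _)]

/-- The length and the end position determine the root, and the root with its end position
determines the index. -/
lemma SquareAt.eq_of_length {w w' : List Letter} {p p' n : ℕ} (h : SquareAt w p n)
    (h' : SquareAt w' p' n) (hl : w.length = w'.length) : (w, p) = (w', p') := by
  obtain ⟨_, e, h1, h2, he⟩ := h
  obtain ⟨_, e', h1', h2', he'⟩ := h'
  have hee : e = e' := by omega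
  subst hee
  have e1 := (endsAt_iff.1 h1.1).2
  have e2 := (endsAt_iff.1 h1'.1).2
  rw [← hl, e1] at e2
  subst e2
  rw [← h1.2, ← h1'.2]

lemma image_length_squareAt (n : ℕ) :
    (fun x : List Letter × ℕ => x.1.length) '' {x | SquareAt x.1 x.2 n} = periods n := by
  ext l
  constructor
  · rintro ⟨x, hx, rfl⟩
    exact hx.length_mem
  · intro hl
    obtain ⟨p, hp⟩ := exists_squareAt hl
    exact ⟨(_, p), hp, length_seg _ _⟩

lemma injOn_length_squareAt (n : ℕ) :
    Set.InjOn (fun x : List Letter × ℕ => x.1.length) {x | SquareAt x.1 x.2 n} :=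
  fun _ hx _ hy h => SquareAt.eq_of_length hx hy h

lemma finite_squareAt (n : ℕ) : {x : List Letter × ℕ | SquareAt x.1 x.2 n}.Finite :=
  Set.Finite.of_finite_image (by rw [image_length_squareAt]; exact finite_periods n)
    (injOn_length_squareAt n)

theorem b_eq_ncard_periods (n : ℕ) : b n = (periods n).ncard := by
  rw [← image_length_squareAt, (injOn_length_squareAt n).ncard_image, b]

/-- The sets counted by `b` at different positions are disjoint, because the `p`-th occurrence of a
word has only one end. -/
theorem B_eq_sum (n : ℕ) : B n = ∑ i ∈ Finset.Icc 1 n, b i := by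
  induction n with
  | zero =>
    have : {x : List Letter × ℕ | ∃ e ≤ 0, SquareAt x.1 x.2 e} = ∅ := by
      ext x
      simp only [Set.mem_ofPred_eq, Set.mem_empty_iff_false, iff_false]
      rintro ⟨e, he, h⟩
      have := h.length_mem.1
      have := h.length_mem.2.1
      omega
    rw [B, this]; simp
  | succ n ih =>
    have hfin : {x : List Letter × ℕ | ∃ e ≤ n, SquareAt x.1 x.2 e}.Finite := by
      have : {x : List Letter × ℕ | ∃ e ≤ n, SquareAt x.1 x.2 e} =
          ⋃ e ∈ Set.Iic n, {x : List Letter × ℕ | SquareAt x.1 x.2 e} := by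
        ext x; simp
      rw [this]
      exact (Set.finite_Iic n).biUnion fun e _ => finite_squareAt e
    rw [Finset.sum_Icc_succ_top (by omega), ← ih, B, B, b,
      ← Set.ncard_union_eq ?_ hfin (finite_squareAt _)]
    · congr 1
      ext x
      simp only [Set.mem_ofPred_eq, Set.mem_union]
      constructor
      · rintro ⟨e, he, h⟩
        by_cases hen : e = n + 1
        · exact Or.inr (hen ▸ h)
        · exact Or.inl ⟨e, by omega, h⟩
      · rintro (⟨e, he, h⟩ | h)
        · exact ⟨e, by omega, h⟩
        · exact ⟨n + 1, le_rfl, h⟩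
    · rw [Set.disjoint_left]
      rintro x ⟨e, he, -, _, -, h, rfl⟩ ⟨-, _, -, h', hx⟩
      have := h.unique h'
      omega

/-! ### The recursion for `b` -/

/-- The squares that end at `n` and begin in the prefix of length `t (r + 3)`. -/
lemma crossing_iff {r n l : ℕ} (hn : D (r + 3) < n) (hn' : n ≤ t (r + 3) + D (r + 3)) :
    (l ∈ periods n ∧ n < t (r + 3) + 2 * l) ↔
      (l = t (r + 3) ∧ 2 * t (r + 3) ≤ n) ∨
      (l + t (r + 2) = t (r + 3) ∧ t (r + 3) + l ≤ n ∧ n ≤ t (r + 3) + D (r + 2)) ∨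
      (l = t r ∧ n < t (r + 3) + 2 * t r) := by
  have T0 := t_add_three r
  have T1 : t (r + 4) = t (r + 3) + t (r + 2) + t (r + 1) := t_add_three (r + 1)
  have D3 := D_add_three r
  have D1 := D_succ r
  have D2 : D (r + 2) = D (r + 1) + t (r + 1) := D_succ (r + 1)
  have D3' : D (r + 3) = D (r + 2) + t (r + 2) := D_succ (r + 2)
  have L0 := t_le_D_succ r
  have L1 := D_lt_t_succ r
  have L3 : D (r + 3) < t (r + 4) := D_lt_t_succ (r + 3)
  have P0 := t_pos r
  have P1 := t_pos (r + 1)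
  have hf3 : img^[r + 1] 3 = t (r + 2) + t (r + 1) := iterate_img_three (r + 1)
  have hf4 : img^[r + 1] 4 = t (r + 3) := iterate_img_four (r + 1)
  have hf2 : img^[r + 2] 2 = t (r + 3) := iterate_img_two (r + 2)
  have hf2' : img^[r + 2] 1 = t (r + 2) := (t_eq_iterate _).symm
  have hf1 : img^[r + 3] 1 = t (r + 3) := (t_eq_iterate _).symm
  have hf0 := iterate_img_zero (r + 3)
  constructor
  · rintro ⟨⟨hl1, hl2, hm⟩, hc⟩
    obtain ⟨M, s₀, e1, e2, e3⟩ := hm.exists_iterate hl1 (by omega)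
    -- Such a run has period at least `t (r + 4)`, too long for a square ending at `n`, or else
    -- begins beyond `t (r + 3)`.
    by_cases hM : r + 4 ≤ M
    · exfalso
      have hx := t_strictMono.monotone hM
      have h1 : img^[M] 1 = t M := (t_eq_iterate _).symm
      obtain _ | s₀ := s₀
      · rw [iterate_img_zero, zero_add, h1] at e1
        omega
      · have := (img_iterate_strictMono M).monotone (show 1 ≤ s₀ + 1 by omega)
        omega
    -- Now `T_{r+3}` is the image under `σ^M` of `T_j`, and the generating letter lies in `T_j`. A
    -- run of a letter other than the last one of `T_j`, or with `j ≥ 3`, ends at or before `D (r +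
    -- 3) < n`; for `j = 0, 1, 2` the last letter is `a`, `b`, `c`.
    · obtain ⟨j, hj⟩ : ∃ j, r + 3 = M + j := ⟨r + 3 - M, by omega⟩
      have hy : t (r + 3) = img^[M] (t j) := by
        rw [t_eq_iterate, t_eq_iterate, hj, Function.iterate_add_apply]
      have hs : s₀ < t j := (img_iterate_strictMono M).lt_iff_lt.1 (by omega)
      have hs' := (img_iterate_strictMono M).monotone (show s₀ + 1 ≤ t j by omega)
      match j with
      | 0 =>
        obtain rfl : M = r + 3 := by omega
        obtain rfl : s₀ = 0 := by rw [t_zero] at hs; omega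
        left
        rw [zero_add] at e1
        omega
      | 1 =>
        obtain rfl : M = r + 2 := by omega
        rw [t_one] at hs
        obtain rfl | rfl : s₀ = 0 ∨ s₀ = 1 := by omega
        · rw [zero_add] at e1
          omega
        · right; left
          rw [show 1 + 1 = 2 from rfl] at e1
          omega
      | 2 =>
        obtain rfl : M = r + 1 := by omega
        rw [t_two] at hs
        by_cases h3 : s₀ = 3
        · subst h3
          right; right
          rw [show 3 + 1 = 4 from rfl] at e1
          omega
        · exfalso
          have := (img_iterate_strictMono (r + 1)).monotone (show s₀ + 1 ≤ 3 by omega)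
          omega
      | j + 3 =>
        exfalso
        -- The run ends by `t (r + 3) + D M ≤ t (r + 3) + D r = D (r + 3)`.
        have := D_strictMono.monotone (show M ≤ r by omega)
        omega
  · rintro (⟨rfl, h⟩ | ⟨h, h1, h2⟩ | ⟨rfl, h⟩)
    · refine ⟨⟨t_pos _, h, match_of_iterate (M := r + 3) (s₀ := 0) ?_ ?_ ?_⟩, by omega⟩
      · rw [zero_add]; omega
      · omega
      · omega
    · refine ⟨⟨by omega, by omega, match_of_iterate (M := r + 2) (s₀ := 1) ?_ ?_ ?_⟩, by omega⟩
      · rw [show 1 + 1 = 2 from rfl]; omega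
      · omega
      · omega
    · refine ⟨⟨t_pos _, by omega, match_of_iterate (M := r + 1) (s₀ := 3) ?_ ?_ ?_⟩, by omega⟩
      · rw [show 3 + 1 = 4 from rfl]; omega
      · omega
      · omega

/-- Squares beginning at or after `t (r + 3)` lie in the second copy of the prefix of length `D (r +
3)` and are shifted back to the first. -/
lemma periods_eq_union {r n : ℕ} (hn : D (r + 3) < n) (hn' : n ≤ t (r + 3) + D (r + 3)) :
    periods n = periods (n - t (r + 3)) ∪ {l | l ∈ periods n ∧ n < t (r + 3) + 2 * l} := by
  have D3 := D_add_three r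
  have ha := agree_D (r + 3) 1
  rw [← t_eq_iterate] at ha
  have key : ∀ l, t (r + 3) + 2 * l ≤ n →
      (Match (n - 2 * l) l l ↔ Match (n - t (r + 3) - 2 * l) l l) := by
    intro l hl
    refine forall₂_congr fun i hi => ?_
    rw [← ha (n - t (r + 3) - 2 * l + i) (by omega), ← ha (n - t (r + 3) - 2 * l + l + i) (by omega),
      show t (r + 3) + (n - t (r + 3) - 2 * l + i) = n - 2 * l + i by omega,
      show t (r + 3) + (n - t (r + 3) - 2 * l + l + i) = n - 2 * l + l + i by omega]
  ext l
  simp only [periods, Set.mem_union, Set.mem_ofPred_eq]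
  constructor
  · rintro ⟨h1, h2, h3⟩
    by_cases hl : n < t (r + 3) + 2 * l
    · exact Or.inr ⟨⟨h1, h2, h3⟩, hl⟩
    · exact Or.inl ⟨h1, by omega, (key l (by omega)).1 h3⟩
  · rintro (⟨h1, h2, h3⟩ | h)
    · exact ⟨h1, by omega, (key l (by omega)).2 h3⟩
    · exact h.1

lemma b_eq_add_crossing {r n : ℕ} (hn : D (r + 3) < n) (hn' : n ≤ t (r + 3) + D (r + 3)) :
    b n = b (n - t (r + 3)) + {l | l ∈ periods n ∧ n < t (r + 3) + 2 * l}.ncard := by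
  have D3 := D_add_three r
  rw [b_eq_ncard_periods n, periods_eq_union hn hn',
    Set.ncard_union_eq ?_ (finite_periods _) ((finite_periods n).subset fun l h => h.1),
    ← periods_eq_union hn hn', b_eq_ncard_periods]
  · rw [Set.disjoint_left]
    rintro l ⟨h1, h2, -⟩ ⟨-, h⟩
    omega

lemma ncard_setOf_eq_and (c : ℕ) (p : Prop) [Decidable p] :
    {l : ℕ | l = c ∧ p}.ncard = if p then 1 else 0 := by
  by_cases hp : p <;> simp [hp]

/-- Beyond `t (r + 3) + D (r + 2)` the runs of `b` and `c` have both stopped contributing; a square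
of period `t (r + 3)` exists as soon as there is room for it. -/
lemma b_block_one {r n : ℕ} (hn : t (r + 3) + D (r + 2) < n) (hn' : n ≤ t (r + 3) + D (r + 3)) :
    b n = b (n - t (r + 3)) + if 2 * t (r + 3) ≤ n then 1 else 0 := by
  have T0 := t_add_three r
  have D3 := D_add_three r
  have D1 := D_succ r
  have D2 : D (r + 2) = D (r + 1) + t (r + 1) := D_succ (r + 1)
  have L0 := t_le_D_succ r
  have L1 := t_lt_succ r
  have P1 := t_pos (r + 1)
  rw [b_eq_add_crossing (r := r) (by omega) hn', ← ncard_setOf_eq_and (t (r + 3))]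
  congr 2
  ext l
  have := crossing_iff (r := r) (n := n) (l := l) (by omega) hn'
  simp only [Set.mem_ofPred_eq, this]
  constructor
  · rintro (h | h | h) <;> omega
  · exact Or.inl

/-- The run of `c` has stopped contributing and `n` is still below `2 t (r + 3)`, so only the period
`t (r + 3) - t (r + 2)` remains. -/
lemma b_block_two {r n : ℕ} (hn : t (r + 3) + D (r + 1) < n) (hn' : n ≤ t (r + 3) + D (r + 2)) :
    b n = b (n - t (r + 3)) + if 2 * t (r + 3) ≤ n + t (r + 2) then 1 else 0 := by
  have T0 := t_add_three r
  have D3 := D_add_three r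
  have D1 := D_succ r
  have D2 : D (r + 2) = D (r + 1) + t (r + 1) := D_succ (r + 1)
  have D3' : D (r + 3) = D (r + 2) + t (r + 2) := D_succ (r + 2)
  have L0 := t_le_D_succ r
  have L2 : D (r + 2) < t (r + 3) := D_lt_t_succ (r + 2)
  rw [b_eq_add_crossing (r := r) (by omega) (by omega),
    ← ncard_setOf_eq_and (t (r + 3) - t (r + 2))]
  congr 2
  ext l
  have := crossing_iff (r := r) (n := n) (l := l) (by omega) (by omega)
  simp only [Set.mem_ofPred_eq, this]
  constructor
  · rintro (h | h | h) <;> omega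
  · intro h
    right; left; omega

/-- Here `n` is too small for the two longer periods. The period `t r` contributes until its squares
no longer begin in the first `t (r + 3)` letters. -/
lemma b_block_three {r n : ℕ} (hn : D (r + 3) < n) (hn' : n ≤ t (r + 3) + D (r + 1)) :
    b n = b (n - t (r + 3)) + if n < t (r + 3) + 2 * t r then 1 else 0 := by
  have T0 := t_add_three r
  have D3 := D_add_three r
  have D1 := D_succ r
  have D2 : D (r + 2) = D (r + 1) + t (r + 1) := D_succ (r + 1)
  have D3' : D (r + 3) = D (r + 2) + t (r + 2) := D_succ (r + 2)
  have L0 := D_lt_t_succ r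
  have L2 : D (r + 2) < t (r + 3) := D_lt_t_succ (r + 2)
  rw [b_eq_add_crossing (r := r) hn (by omega), ← ncard_setOf_eq_and (t r)]
  congr 2
  ext l
  have := crossing_iff (r := r) (n := n) (l := l) hn (by omega)
  simp only [Set.mem_ofPred_eq, this]
  constructor
  · rintro (h | h | h) <;> omega
  · intro h
    right; right; exact h

/-- The prefix `abacaba` is free of squares; only periods up to 3 need checking. -/
lemma b_eq_zero {n : ℕ} (hn : n ≤ 7) : b n = 0 := by
  rw [b_eq_ncard_periods, Set.ncard_eq_zero (finite_periods n), Set.eq_empty_iff_forall_notMem]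
  rintro l ⟨h1, h2, h3⟩
  have a0 := u_zero
  have a1 := u_one
  have a2 := u_two
  have a3 := u_three
  have a4 := u_four
  have a5 := u_five
  have a6 := u_six
  have b0 := h3 0 h1
  have hl : l < 4 := by omega
  by_cases h4 : l = 1
  · subst h4
    interval_cases n <;> simp_all
  · have b1 := h3 1 (by omega)
    obtain rfl | rfl : l = 2 ∨ l = 3 := by omega
    · interval_cases n <;> simp_all
    · interval_cases n <;> simp_all

/-! ### The first occurrence of the kernel words -/

/-- The last letters of the three images, `b`, `c`, `a`, are distinct. -/
lemma u_img_succ_pred_inj {m n : ℕ} (h : u (img (m + 1) - 1) = u (img (n + 1) - 1)) :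
    u m = u n := by
  have key : ∀ n, u (img (n + 1) - 1) = match u n with | .a => .b | .b => .c | .c => .a := by
    intro n
    cases hu : u n
    · rw [img_a hu]; exact u_img_a hu
    · rw [img_b hu]; exact u_img_b hu
    · rw [img_c hu]; exact u_img n
  rw [key, key] at h
  cases hm : u m <;> cases hn : u n <;> simp_all

/-- An occurrence desubstitutes to an occurrence one level lower: the first letter ends an image and
determines the letter below, and the prefix part pulls back from length `D (M + 1) + 1` to `D M +
1`. At the bottom stands `aa`, which first occurs at the end of `T_3`. -/
lemma kernel_occurrence_ge {M p : ℕ} (h : u p = u (t (M + 3) - 1))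
    (h' : ∀ i ≤ D M, u (p + 1 + i) = u i) : t (M + 3) ≤ p + 1 := by
  induction M generalizing p with
  | zero =>
    have h1 := h' 0 (by omega)
    rw [u_zero, add_zero] at h1
    rw [show t (0 + 3) - 1 = 6 from rfl, u_six] at h
    rw [show t (0 + 3) = 7 from rfl]
    by_contra hlt
    have := u_one
    have := u_three
    have := u_five
    have hp : p < 6 := by omega
    interval_cases p <;> simp_all
  | succ M ih =>
    have h1 := h' 0 (by omega)
    rw [u_zero, add_zero] at h1
    obtain ⟨p', hp'⟩ := exists_img_of_u_eq_a h1
    obtain _ | p' := p'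
    · simp [img] at hp'
    have hT : t (M + 1 + 3) = img (t (M + 3)) := by
      rw [t_eq_iterate, t_eq_iterate (M + 3), ← Function.iterate_succ_apply' img]
    have hpos := t_pos (M + 3)
    have hp'' : t (M + 3) ≤ p' + 1 := by
      apply ih
      · apply u_img_succ_pred_inj
        rw [← hp', Nat.sub_add_cancel hpos, ← hT, ← h, Nat.add_sub_cancel]
      · intro i hi
        -- The range is `D (M + 1) + 1`; its last letter is the one that decides the letter at `D M`
        -- below.
        have h0 : ∀ j < img (D M) + 2, u (img (p' + 1) + j) = u (img 0 + j) := by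
          intro j hj
          rw [← hp', h' j (by simp only [D]; omega)]
          simp [img]
        have key : ∀ i ≤ D M, u (p' + 1 + i) = u i := by
          intro i
          induction i using Nat.strong_induction_on with
          | _ i ihi =>
            intro hi
            have e := img_add_of_agree (p := p' + 1) (n := i) fun j hj => ihi j hj (by omega)
            have := agree_of_img h0 i (by
              have := img_strictMono.monotone hi
              omega)
            rwa [zero_add] at this
        exact key i hi
    rw [hT, hp']
    exact img_strictMono.monotone hp''

lemma kernel_eq (r : ℕ) : kernel (r + 4) = u (t (r + 3) - 1) :: pre (D r + 1) := by
  have hk := k_eq r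
  have hD := D_lt_t_succ r
  rw [kernel, hk]
  congr 1
  · rw [List.getLastD_eq_getLast?, List.getLast?_eq_getElem?, getElem?_word]
    · rfl
    · have := t_pos (r + 3); unfold t at *; omega
  · rw [word_eq_pre, pre, pre, ← List.map_take, List.take_range]
    congr 2; omega

lemma endsAt_kernel_iff {r n : ℕ} : EndsAt (kernel (r + 4)) n ↔
    D r + 2 ≤ n ∧ u (n - (D r + 2)) = u (t (r + 3) - 1) ∧
      ∀ i ≤ D r, u (n - (D r + 2) + 1 + i) = u i := by
  rw [endsAt_iff, kernel_eq, List.length_cons, length_pre]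
  refine and_congr_right fun _ => ?_
  rw [seg, List.range_succ_eq_map, List.map_cons, List.cons.injEq, add_zero]
  refine and_congr_right fun _ => ?_
  rw [List.map_map, pre]
  simp only [List.map_inj_left, List.mem_range, Function.comp, Nat.lt_succ_iff]
  refine forall₂_congr fun i _ => ?_
  rw [show n - (D r + 1 + 1) + i.succ = n - (D r + 2) + 1 + i by omega]

/-- The first occurrence straddles the end of `T_{r+3}`: the last letter there, then the prefix of
length `D r + 1`, ending at `t (r + 3) + D r + 1 = D (r + 3) + 1`. -/
theorem pos_kernel (r : ℕ) : pos (kernel (r + 4)) 1 = D (r + 3) + 1 := by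
  have D3 := D_add_three r
  have P := t_pos (r + 3)
  have hmin : ∀ n, EndsAt (kernel (r + 4)) n → D (r + 3) + 1 ≤ n := by
    intro n h
    obtain ⟨h1, h2, h3⟩ := endsAt_kernel_iff.1 h
    have := kernel_occurrence_ge h2 h3
    omega
  have hocc : EndsAt (kernel (r + 4)) (D (r + 3) + 1) := by
    refine endsAt_kernel_iff.2 ⟨by omega, ?_, fun i hi => ?_⟩
    · congr 1; omega
    · have := agree_D (r + 3) 1 i (by omega)
      rw [← t_eq_iterate] at this
      rw [← this]
      congr 1; omega
  have h1 : IsOcc (kernel (r + 4)) 1 (D (r + 3) + 1) := by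
    refine ⟨hocc, ?_⟩
    rw [Set.ncard_eq_one]
    refine ⟨D (r + 3) + 1, ?_⟩
    ext i
    simp only [Set.mem_ofPred_eq, Set.mem_singleton_iff]
    constructor
    · rintro ⟨hi, ho⟩
      have := hmin i ho
      omega
    · rintro rfl
      exact ⟨le_rfl, hocc⟩
  refine le_antisymm (Nat.sInf_le h1) (le_csInf ⟨_, h1⟩ fun n hn => hmin n hn.1)

/-! ### The blocks -/

/-- The end of the block preceding the block `j` of level `r + 4`. -/
def lo : Idx → ℕ → ℕ
  | .three, r => D (r + 3)
  | .two, r => t (r + 3) + D (r + 1)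
  | .one, r => t (r + 3) + D (r + 2)

/-- The end of the block `j` of level `r + 4`. -/
def hi : Idx → ℕ → ℕ
  | .three, r => t (r + 3) + D (r + 1)
  | .two, r => t (r + 3) + D (r + 2)
  | .one, r => D (r + 4)

lemma gMin_eq (j : Idx) (r : ℕ) : gMin j (r + 4) 1 = lo j r + 1 := by
  have T0 := t_add_three r
  have T1 : t (r + 4) = t (r + 3) + t (r + 2) + t (r + 1) := t_add_three (r + 1)
  have D3 := D_add_three r
  have D1 := D_succ r
  have D2 : D (r + 2) = D (r + 1) + t (r + 1) := D_succ (r + 1)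
  have hp := pos_kernel r
  cases j
  · change pos (kernel (r + 4)) 1 + t (r + 3) - t (r + 2) = t (r + 3) + D (r + 2) + 1
    omega
  · change pos (kernel (r + 4)) 1 + 2 * t (r + 3) - t (r + 4) = t (r + 3) + D (r + 1) + 1
    omega
  · exact hp

lemma gMax_eq (j : Idx) (r : ℕ) : gMax j (r + 4) 1 = hi j r := by
  have T0 := t_add_three r
  have T1 : t (r + 4) = t (r + 3) + t (r + 2) + t (r + 1) := t_add_three (r + 1)
  have D3 := D_add_three r
  have D1 := D_succ r
  have D2 : D (r + 2) = D (r + 1) + t (r + 1) := D_succ (r + 1)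
  have D4 : D (r + 4) = D (r + 3) + t (r + 3) := D_succ (r + 3)
  have hp := pos_kernel r
  cases j
  · change pos (kernel (r + 4)) 1 + t (r + 3) - 1 = D (r + 4)
    omega
  · change pos (kernel (r + 4)) 1 + t (r + 3) - t (r + 2) - 1 = t (r + 3) + D (r + 2)
    omega
  · change pos (kernel (r + 4)) 1 + 2 * t (r + 3) - t (r + 4) - 1 = t (r + 3) + D (r + 1)
    omega

/-- From here on a block is the half-open interval from `lo` (excluded) to `hi` (included), and
consecutive blocks share these bounds. -/
lemma block_eq (j : Idx) (r : ℕ) :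
    block j (r + 4) 1 = List.range' (lo j r + 1) (hi j r - lo j r) := by
  rw [block, gMin_eq, gMax_eq, Nat.add_sub_add_right]

lemma mem_block_iff {j : Idx} {r n : ℕ} : n ∈ block j (r + 4) 1 ↔ lo j r < n ∧ n ≤ hi j r := by
  rw [block_eq, List.mem_range'_1]
  omega

lemma hi_one_sub (r : ℕ) : hi .one r - lo .one r = t (r + 2) := by
  have D3 : D (r + 3) = D (r + 2) + t (r + 2) := D_succ (r + 2)
  have D4 : D (r + 4) = D (r + 3) + t (r + 3) := D_succ (r + 3)
  simp only [lo, hi]; omega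

lemma hi_two_sub (r : ℕ) : hi .two r - lo .two r = t (r + 1) := by
  have D2 : D (r + 2) = D (r + 1) + t (r + 1) := D_succ (r + 1)
  simp only [lo, hi]; omega

lemma hi_three_sub (r : ℕ) : hi .three r - lo .three r = t r := by
  have D3 := D_add_three r
  have D1 := D_succ r
  simp only [lo, hi]; omega

lemma lo_lt_hi (j : Idx) (r : ℕ) : lo j r < hi j r := by
  have h0 := t_pos r
  have h1 := t_pos (r + 1)
  have h2 := t_pos (r + 2)
  have e0 := hi_three_sub r
  have e1 := hi_two_sub r
  have e2 := hi_one_sub r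
  cases j <;> omega

lemma length_block (j : Idx) (r : ℕ) : (block j (r + 4) 1).length = hi j r - lo j r := by
  rw [block_eq, List.length_range']

lemma D_le_lo (j : Idx) (r : ℕ) : D (r + 3) ≤ lo j r := by
  have h0 := lo_lt_hi .three r
  have h1 := lo_lt_hi .two r
  cases j <;> simp only [lo, hi] at * <;> omega

lemma hi_le_D (j : Idx) (r : ℕ) : hi j r ≤ D (r + 4) := by
  have h1 := lo_lt_hi .two r
  have h2 := lo_lt_hi .one r
  cases j <;> simp only [lo, hi] at * <;> omega

lemma t_le_lo (j : Idx) (r : ℕ) : t (r + 3) ≤ lo j r := by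
  have h0 := D_le_lo j r
  have h1 := D_add_three r
  omega

lemma exists_level {n : ℕ} (hn : 8 ≤ n) : ∃ r, D (r + 3) < n ∧ n ≤ D (r + 4) := by
  have h3 : D 3 = 7 := by rw [D_succ, D_succ, D_succ]; rfl
  have hex : ∃ r, n ≤ D (r + 4) :=
    ⟨n, (D_strictMono.le_apply).trans (D_strictMono.monotone (by omega))⟩
  classical
  refine ⟨Nat.find hex, ?_, Nat.find_spec hex⟩
  rcases h : Nat.find hex with _ | r
  · rw [zero_add, h3]; omega
  · have := Nat.find_min hex (m := r) (by omega)
    rw [show r + 1 + 3 = r + 4 by omega]; omega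

lemma level_unique {n r r' : ℕ} (h : D (r + 3) < n ∧ n ≤ D (r + 4))
    (h' : D (r' + 3) < n ∧ n ≤ D (r' + 4)) : r = r' := by
  have h1 := D_strictMono.lt_iff_lt.1 (h.1.trans_le h'.2)
  have h2 := D_strictMono.lt_iff_lt.1 (h'.1.trans_le h.2)
  omega

lemma exists_block {n r : ℕ} (h : D (r + 3) < n ∧ n ≤ D (r + 4)) :
    ∃ j, lo j r < n ∧ n ≤ hi j r := by
  by_cases h3 : n ≤ hi .three r
  · exact ⟨.three, h.1, h3⟩
  · by_cases h2 : n ≤ hi .two r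
    · exact ⟨.two, not_le.1 h3, h2⟩
    · exact ⟨.one, not_le.1 h2, h.2⟩

lemma block_unique {n r : ℕ} {j j' : Idx} (h : lo j r < n ∧ n ≤ hi j r)
    (h' : lo j' r < n ∧ n ≤ hi j' r) : j = j' := by
  have h1 := lo_lt_hi .two r
  have h2 := lo_lt_hi .one r
  have h3 := lo_lt_hi .three r
  cases j <;> cases j' <;> first | rfl | (exfalso; simp only [lo, hi] at *; omega)

lemma level_of_mem {n r : ℕ} {j : Idx} (h : lo j r < n ∧ n ≤ hi j r) :
    D (r + 3) < n ∧ n ≤ D (r + 4) :=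
  ⟨(D_le_lo j r).trans_lt h.1, h.2.trans (hi_le_D j r)⟩

theorem existsUnique_block {n : ℕ} (hn : 8 ≤ n) :
    ∃! q : Idx × ℕ, 4 ≤ q.2 ∧ n ∈ block q.1 q.2 1 := by
  obtain ⟨r, hr⟩ := exists_level hn
  obtain ⟨j, hj⟩ := exists_block hr
  refine ⟨(j, r + 4), ⟨by simp, mem_block_iff.2 hj⟩, ?_⟩
  rintro ⟨j', m⟩ ⟨hm, h⟩
  obtain ⟨r', rfl⟩ := Nat.exists_eq_add_of_le' hm
  have h := mem_block_iff.1 h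
  obtain rfl := level_unique hr (level_of_mem h)
  rw [block_unique hj h]

lemma D_values : D 1 = 1 ∧ D 2 = 3 ∧ D 3 = 7 ∧ D 4 = 14 ∧ D 5 = 27 ∧ D 6 = 51 := by
  simp only [D_succ]
  decide

lemma t_values : t 3 = 7 ∧ t 4 = 13 ∧ t 5 = 24 ∧ t 6 = 44 := by decide

lemma level_ge {n r : ℕ} {j : Idx} (h : lo j r < n ∧ n ≤ hi j r) :
    (52 ≤ n → 3 ≤ r) ∧ (32 ≤ n → j = .two → 2 ≤ r) ∧ (21 ≤ n → j = .one → 1 ≤ r) := by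
  obtain ⟨d1, d2, d3, d4, d5, d6⟩ := D_values
  obtain ⟨t3, t4, t5, t6⟩ := t_values
  obtain ⟨-, h2⟩ := level_of_mem h
  refine ⟨fun hn => ?_, fun hn hj => ?_, fun hn hj => ?_⟩
  · have := D_strictMono.lt_iff_lt.1 (show D 6 < D (r + 4) by omega)
    omega
  · have := D_strictMono.lt_iff_lt.1 (show D 5 < D (r + 4) by omega)
    omega
  · have := D_strictMono.lt_iff_lt.1 (show D 4 < D (r + 4) by omega)
    omega

/-! ### The thresholds -/

section Thresholds

variable (r : ℕ)

/-- The thresholds `θ` are block ends, possibly translated, plus one. The identities `D_closed` and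
`t_add_three` reduce them all to linear arithmetic. -/
lemma θ1_eq : (Trip.ofLevel (r + 4)).θ1 = (lo .three r : ℤ) + 1 := by
  change ((t (r + 4) : ℤ) + t (r + 2) - 1) / 2 = (D (r + 3) : ℤ) + 1
  have : 2 * D (r + 3) + 3 = t (r + 4) + t (r + 2) := D_closed (r + 2)
  omega

lemma θ4_eq : (Trip.ofLevel (r + 4)).θ4 = (hi .three r : ℤ) + 1 := by
  change (-(t (r + 4) : ℤ) + 4 * t (r + 3) + t (r + 2) - 1) / 2 =
    ((t (r + 3) + D (r + 1) : ℕ) : ℤ) + 1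
  have := D_closed r
  have T0 := t_add_three r
  have T1 : t (r + 4) = t (r + 3) + t (r + 2) + t (r + 1) := t_add_three (r + 1)
  omega

lemma θ7_eq : (Trip.ofLevel (r + 4)).θ7 = (hi .two r : ℤ) + 1 := by
  change ((t (r + 4) : ℤ) + 2 * t (r + 3) - t (r + 2) - 1) / 2 =
    ((t (r + 3) + D (r + 2) : ℕ) : ℤ) + 1
  have : 2 * D (r + 2) + 3 = t (r + 3) + t (r + 1) := D_closed (r + 1)
  have T1 : t (r + 4) = t (r + 3) + t (r + 2) + t (r + 1) := t_add_three (r + 1)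
  omega

lemma θ10_eq : (Trip.ofLevel (r + 4)).θ10 = (hi .one r : ℤ) + 1 := by
  change ((t (r + 4) : ℤ) + 2 * t (r + 3) + t (r + 2) - 1) / 2 = (D (r + 4) : ℤ) + 1
  have : 2 * D (r + 3) + 3 = t (r + 4) + t (r + 2) := D_closed (r + 2)
  have D4 : D (r + 4) = D (r + 3) + t (r + 3) := D_succ (r + 3)
  omega

lemma θ2_eq : (Trip.ofLevel (r + 7)).θ2 = (hi .three r : ℤ) + t (r + 6) + 1 := by
  change (-5 * (t (r + 7) : ℤ) + 10 * t (r + 6) + 3 * t (r + 5) - 1) / 2 =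
    ((t (r + 3) + D (r + 1) : ℕ) : ℤ) + t (r + 6) + 1
  have := D_closed r
  have T0 := t_add_three r
  have T1 : t (r + 4) = t (r + 3) + t (r + 2) + t (r + 1) := t_add_three (r + 1)
  have T2 : t (r + 5) = t (r + 4) + t (r + 3) + t (r + 2) := t_add_three (r + 2)
  have T3 : t (r + 6) = t (r + 5) + t (r + 4) + t (r + 3) := t_add_three (r + 3)
  have T4 : t (r + 7) = t (r + 6) + t (r + 5) + t (r + 4) := t_add_three (r + 4)
  omega

lemma θ3_eq : (Trip.ofLevel (r + 7)).θ3 = (hi .two r : ℤ) + t (r + 6) + 1 := by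
  change (-(t (r + 7) : ℤ) + 6 * t (r + 6) - 3 * t (r + 5) - 1) / 2 =
    ((t (r + 3) + D (r + 2) : ℕ) : ℤ) + t (r + 6) + 1
  have : 2 * D (r + 2) + 3 = t (r + 3) + t (r + 1) := D_closed (r + 1)
  have T1 : t (r + 4) = t (r + 3) + t (r + 2) + t (r + 1) := t_add_three (r + 1)
  have T2 : t (r + 5) = t (r + 4) + t (r + 3) + t (r + 2) := t_add_three (r + 2)
  have T3 : t (r + 6) = t (r + 5) + t (r + 4) + t (r + 3) := t_add_three (r + 3)
  have T4 : t (r + 7) = t (r + 6) + t (r + 5) + t (r + 4) := t_add_three (r + 4)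
  omega

/-- The thresholds `η` are where the extra square appears or disappears; this one bounds the squares
of period `t r`. -/
lemma η1_eq : (Trip.ofLevel (r + 4)).η1 = (t (r + 3) : ℤ) + 2 * t r := by
  change -2 * (t (r + 4) : ℤ) + 5 * t (r + 3) = t (r + 3) + 2 * t r
  have T0 := t_add_three r
  have T1 : t (r + 4) = t (r + 3) + t (r + 2) + t (r + 1) := t_add_three (r + 1)
  omega

lemma θ5_eq : (Trip.ofLevel (r + 6)).θ5 = (hi .three r : ℤ) + t (r + 5) + 1 := by
  change (3 * (t (r + 6) : ℤ) - 5 * t (r + 4) - 1) / 2 =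
    ((t (r + 3) + D (r + 1) : ℕ) : ℤ) + t (r + 5) + 1
  have := D_closed r
  have T0 := t_add_three r
  have T1 : t (r + 4) = t (r + 3) + t (r + 2) + t (r + 1) := t_add_three (r + 1)
  have T2 : t (r + 5) = t (r + 4) + t (r + 3) + t (r + 2) := t_add_three (r + 2)
  have T3 : t (r + 6) = t (r + 5) + t (r + 4) + t (r + 3) := t_add_three (r + 3)
  omega

lemma θ6_eq : (Trip.ofLevel (r + 6)).θ6 = (hi .two r : ℤ) + t (r + 5) + 1 := by
  change (3 * (t (r + 6) : ℤ) - 2 * t (r + 5) - t (r + 4) - 1) / 2 =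
    ((t (r + 3) + D (r + 2) : ℕ) : ℤ) + t (r + 5) + 1
  have : 2 * D (r + 2) + 3 = t (r + 3) + t (r + 1) := D_closed (r + 1)
  have T1 : t (r + 4) = t (r + 3) + t (r + 2) + t (r + 1) := t_add_three (r + 1)
  have T2 : t (r + 5) = t (r + 4) + t (r + 3) + t (r + 2) := t_add_three (r + 2)
  have T3 : t (r + 6) = t (r + 5) + t (r + 4) + t (r + 3) := t_add_three (r + 3)
  omega

lemma η2_eq : (Trip.ofLevel (r + 4)).η2 = 2 * (t (r + 3) : ℤ) - t (r + 2) := rfl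

lemma θ8_eq : (Trip.ofLevel (r + 5)).θ8 = (hi .three r : ℤ) + t (r + 4) + 1 := by
  change ((t (r + 5) : ℤ) + 3 * t (r + 3) - 1) / 2 =
    ((t (r + 3) + D (r + 1) : ℕ) : ℤ) + t (r + 4) + 1
  have := D_closed r
  have T0 := t_add_three r
  have T1 : t (r + 4) = t (r + 3) + t (r + 2) + t (r + 1) := t_add_three (r + 1)
  have T2 : t (r + 5) = t (r + 4) + t (r + 3) + t (r + 2) := t_add_three (r + 2)
  omega

lemma θ9_eq : (Trip.ofLevel (r + 5)).θ9 = (hi .two r : ℤ) + t (r + 4) + 1 := by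
  change (-(t (r + 5) : ℤ) + 4 * t (r + 4) + 3 * t (r + 3) - 1) / 2 =
    ((t (r + 3) + D (r + 2) : ℕ) : ℤ) + t (r + 4) + 1
  have : 2 * D (r + 2) + 3 = t (r + 3) + t (r + 1) := D_closed (r + 1)
  have T1 : t (r + 4) = t (r + 3) + t (r + 2) + t (r + 1) := t_add_three (r + 1)
  have T2 : t (r + 5) = t (r + 4) + t (r + 3) + t (r + 2) := t_add_three (r + 2)
  omega

lemma η3_eq : (Trip.ofLevel (r + 4)).η3 = 2 * (t (r + 3) : ℤ) := rfl

end Thresholds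

/-- The blocks of level `r + 4` are translated to the blocks `j = 1, 2, 3` of the levels
`r + 5`, `r + 6`, `r + 7`. -/
lemma lo_one_succ (r : ℕ) : lo .one (r + 1) = lo .three r + t (r + 4) := by
  simp only [lo]; rw [add_comm]

lemma lo_two_succ (r : ℕ) : lo .two (r + 2) = lo .three r + t (r + 5) := by
  simp only [lo]; rw [add_comm]

lemma lo_three_succ (r : ℕ) : lo .three (r + 3) = lo .three r + t (r + 6) := by
  simp only [lo]; exact D_add_three (r + 3)

lemma hi_one_succ (r : ℕ) : hi .one (r + 1) = hi .one r + t (r + 4) := D_succ (r + 4)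

lemma hi_two_succ (r : ℕ) : hi .two (r + 2) = hi .one r + t (r + 5) := by
  simp only [hi]; rw [add_comm]

lemma hi_three_succ (r : ℕ) : hi .three (r + 3) = hi .one r + t (r + 6) := by
  simp only [hi]; rw [add_comm]

theorem thresholds_three (r : ℕ) :
    (Trip.ofLevel (r + 7)).θ2 = gMin .three (r + 7) 1 + (block .three (r + 4) 1).length ∧
    (Trip.ofLevel (r + 7)).θ3 = gMin .three (r + 7) 1 + (block .three (r + 4) 1).length
      + (block .two (r + 4) 1).length ∧
    (Trip.ofLevel (r + 7)).η1 = gMin .three (r + 7) 1 + t (r + 3) - k (r + 4) + 1 ∧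
    (Trip.ofLevel (r + 7)).θ3 < (Trip.ofLevel (r + 7)).η1 ∧
    (Trip.ofLevel (r + 7)).η1 < (Trip.ofLevel (r + 7)).θ4 ∧
    gMin .three (r + 7) 1 = gMin .three (r + 4) 1 + t (r + 6) := by
  have e1 := gMin_eq .three (r + 3)
  have e2 := gMin_eq .three r
  have e3 := lo_three_succ r
  have e4 := lo_lt_hi .three r
  have e5 : lo .two r = hi .three r := rfl
  have e6 := lo_lt_hi .two r
  have e7 := k_eq r
  have e8 : (Trip.ofLevel (r + 7)).η1 = (t (r + 6) : ℤ) + 2 * t (r + 3) := η1_eq (r + 3)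
  have e9 : (Trip.ofLevel (r + 7)).θ4 = (hi .three (r + 3) : ℤ) + 1 := θ4_eq (r + 3)
  have e10 : lo .three r = D (r + 3) := rfl
  have e11 : hi .two r = t (r + 3) + D (r + 2) := rfl
  have e12 := D_add_three r
  have e13 : D (r + 2) < t (r + 3) := D_lt_t_succ (r + 2)
  have e14 : hi .three (r + 3) = t (r + 6) + D (r + 4) := rfl
  have e15 : D (r + 4) = D (r + 3) + t (r + 3) := D_succ (r + 3)
  have e16 : 2 * D (r + 2) + 3 = t (r + 3) + t (r + 1) := D_closed (r + 1)
  have e17 : t (r + 1) < t (r + 3) := t_strictMono (by omega)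
  rw [length_block, length_block, θ2_eq, θ3_eq, e8, e9, e1, e2]
  refine ⟨?_, ?_, ?_, ?_, ?_, ?_⟩ <;> omega

theorem thresholds_two (r : ℕ) :
    (Trip.ofLevel (r + 6)).θ5 = gMin .two (r + 6) 1 + (block .three (r + 4) 1).length ∧
    (Trip.ofLevel (r + 6)).η2 = gMin .two (r + 6) 1 + t (r + 3) - k (r + 6) + 1 ∧
    (Trip.ofLevel (r + 6)).θ6 = gMin .two (r + 6) 1 + (block .three (r + 4) 1).length
      + (block .two (r + 4) 1).length ∧
    (Trip.ofLevel (r + 6)).θ5 < (Trip.ofLevel (r + 6)).η2 ∧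
    (Trip.ofLevel (r + 6)).η2 ≤ (Trip.ofLevel (r + 6)).θ6 ∧
    gMin .two (r + 6) 1 = gMin .three (r + 4) 1 + t (r + 5) := by
  have e1 := gMin_eq .two (r + 2)
  have e2 := gMin_eq .three r
  have e3 := lo_two_succ r
  have e4 := lo_lt_hi .three r
  have e5 : lo .two r = hi .three r := rfl
  have e6 := lo_lt_hi .two r
  have e7 := k_eq (r + 2)
  have e8 : (Trip.ofLevel (r + 6)).η2 = 2 * (t (r + 5) : ℤ) - t (r + 4) := η2_eq (r + 2)
  have e10 : lo .three r = D (r + 3) := rfl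
  have e11 : hi .two r = t (r + 3) + D (r + 2) := rfl
  have e12 : hi .three r = t (r + 3) + D (r + 1) := rfl
  have e13 : D (r + 1) < t (r + 2) := D_lt_t_succ (r + 1)
  have e15 : D (r + 3) = D (r + 2) + t (r + 2) := D_succ (r + 2)
  have e16 := D_closed r
  have e17 : t r < t (r + 2) := t_strictMono (by omega)
  have e14 : t (r + 2) ≤ D (r + 2) + 1 := t_le_D_succ (r + 2)
  have T2 : t (r + 5) = t (r + 4) + t (r + 3) + t (r + 2) := t_add_three (r + 2)
  rw [length_block, length_block, θ5_eq, θ6_eq, e8, e1, e2, e7]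
  refine ⟨?_, ?_, ?_, ?_, ?_, ?_⟩ <;> omega

theorem thresholds_one (r : ℕ) :
    (Trip.ofLevel (r + 5)).θ8 = gMin .one (r + 5) 1 + (block .three (r + 4) 1).length ∧
    (Trip.ofLevel (r + 5)).θ9 = gMin .one (r + 5) 1 + (block .three (r + 4) 1).length
      + (block .two (r + 4) 1).length ∧
    (Trip.ofLevel (r + 5)).η3 = gMin .one (r + 5) 1 + t (r + 3) - k (r + 5) + 1 ∧
    (Trip.ofLevel (r + 5)).θ9 < (Trip.ofLevel (r + 5)).η3 ∧
    (Trip.ofLevel (r + 5)).η3 < (Trip.ofLevel (r + 5)).θ10 ∧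
    gMin .one (r + 5) 1 = gMin .three (r + 4) 1 + t (r + 4) := by
  have e1 := gMin_eq .one (r + 1)
  have e2 := gMin_eq .three r
  have e3 := lo_one_succ r
  have e4 := lo_lt_hi .three r
  have e5 : lo .two r = hi .three r := rfl
  have e6 := lo_lt_hi .two r
  have e7 := k_eq (r + 1)
  have e8 : (Trip.ofLevel (r + 5)).η3 = 2 * (t (r + 4) : ℤ) := η3_eq (r + 1)
  have e9 : (Trip.ofLevel (r + 5)).θ10 = (hi .one (r + 1) : ℤ) + 1 := θ10_eq (r + 1)
  have e10 : lo .three r = D (r + 3) := rfl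
  have e11 : hi .two r = t (r + 3) + D (r + 2) := rfl
  have e12 : hi .one (r + 1) = D (r + 5) := rfl
  have e13 : D (r + 5) = D (r + 4) + t (r + 4) := D_succ (r + 4)
  have e15 : D (r + 3) = D (r + 2) + t (r + 2) := D_succ (r + 2)
  have e16 : D (r + 4) = D (r + 1) + t (r + 4) := D_add_three (r + 1)
  have e17 : D (r + 4) = D (r + 3) + t (r + 3) := D_succ (r + 3)
  have e18 : D (r + 2) = D (r + 1) + t (r + 1) := D_succ (r + 1)
  have e19 := t_pos (r + 2)
  have T1 : t (r + 4) = t (r + 3) + t (r + 2) + t (r + 1) := t_add_three (r + 1)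
  have T0 := t_add_three r
  have e21 : 2 * D (r + 2) + 3 = t (r + 3) + t (r + 1) := D_closed (r + 1)
  have e22 : t r < t (r + 2) := t_strictMono (by omega)
  have e20 : D (r + 1) < t (r + 2) := D_lt_t_succ (r + 1)
  rw [length_block, length_block, θ8_eq, θ9_eq, e8, e9, e1, e2, e7]
  refine ⟨?_, ?_, ?_, ?_, ?_, ?_⟩ <;> omega

/-! ### The recursive description of `b` -/

/-- Turns a pointwise recursion with a two-valued increment into an identity of vectors. -/
lemma map_range'_eq_zipWith {g : ℕ → ℕ} {s s' L p q c d : ℕ} (hpq : p + q = L)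
    (h : ∀ i < L, g (s + i) = g (s' + i) + if i < p then c else d) :
    (List.range' s L).map g = List.zipWith (· + ·) ((List.range' s' L).map g)
      (List.replicate p c ++ List.replicate q d) := by
  subst hpq
  apply List.ext_getElem
  · simp
  · intro i h1 h2
    have hi : i < p + q := by simpa using h1
    simp [List.getElem_append, h i hi]

lemma bVec_eq (j : Idx) (r : ℕ) :
    bVec j (r + 4) = (List.range' (lo j r + 1) (hi j r - lo j r)).map b := by
  rw [bVec, block_eq]

lemma bCat_eq (r : ℕ) : bCat (r + 4) = (List.range' (D (r + 3) + 1) (t (r + 3))).map b := by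
  have e1 := lo_lt_hi .three r
  have e2 := lo_lt_hi .two r
  have e3 := lo_lt_hi .one r
  have e4 : lo .two r = hi .three r := rfl
  have e5 : lo .one r = hi .two r := rfl
  have e6 : lo .three r = D (r + 3) := rfl
  have e7 : hi .one r = D (r + 4) := rfl
  have e8 : D (r + 4) = D (r + 3) + t (r + 3) := D_succ (r + 3)
  rw [bCat, bVec_eq, bVec_eq, bVec_eq, ← List.map_append, ← List.map_append,
    show lo .two r + 1 = lo .three r + 1 + (hi .three r - lo .three r) by omega,
    List.range'_append_1,
    show lo .one r + 1 = lo .three r + 1 + (hi .three r - lo .three r + (hi .two r - lo .two r))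
      by omega, List.range'_append_1, e6]
  congr 2
  omega

theorem bVec_one_succ (r : ℕ) : bVec .one (r + 5) = List.zipWith (· + ·) (bCat (r + 4))
    (List.replicate (t (r + 3) + 1 - k (r + 5)) 0 ++ List.replicate (k (r + 5) - 1) 1) := by
  have e1 := k_eq (r + 1)
  have e2 : D (r + 1) < t (r + 2) := D_lt_t_succ (r + 1)
  have e3 : t (r + 2) < t (r + 3) := t_lt_succ (r + 2)
  have e4 : D (r + 4) = D (r + 1) + t (r + 4) := D_add_three (r + 1)
  have e5 : D (r + 4) = D (r + 3) + t (r + 3) := D_succ (r + 3)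
  have hb : ∀ n, t (r + 4) + D (r + 3) < n → n ≤ t (r + 4) + D (r + 4) →
    b n = b (n - t (r + 4)) + if 2 * t (r + 4) ≤ n then 1 else 0 :=
      fun _ => b_block_one (r := r + 1)
  have hs : hi .one (r + 1) - lo .one (r + 1) = t (r + 3) := hi_one_sub (r + 1)
  have hl : lo .one (r + 1) = t (r + 4) + D (r + 3) := rfl
  rw [bVec_eq .one (r + 1), bCat_eq, hs, hl, e1]
  refine map_range'_eq_zipWith (by omega) fun i hi => ?_
  rw [hb _ (by omega) (by omega),
    show t (r + 4) + D (r + 3) + 1 + i - t (r + 4) = D (r + 3) + 1 + i by omega]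
  split_ifs <;> omega

theorem bVec_two_succ (r : ℕ) : bVec .two (r + 6) = List.zipWith (· + ·) (bCat (r + 4))
    (List.replicate (t (r + 3) + 1 - k (r + 6)) 0 ++ List.replicate (k (r + 6) - 1) 1) := by
  have e1 := k_eq (r + 2)
  have e2 : D (r + 2) < t (r + 3) := D_lt_t_succ (r + 2)
  have e4 : D (r + 5) = D (r + 2) + t (r + 5) := D_add_three (r + 2)
  have e5 : D (r + 4) = D (r + 3) + t (r + 3) := D_succ (r + 3)
  have e6 : D (r + 5) = D (r + 4) + t (r + 4) := D_succ (r + 4)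
  have hb : ∀ n, t (r + 5) + D (r + 3) < n → n ≤ t (r + 5) + D (r + 4) →
    b n = b (n - t (r + 5)) + if 2 * t (r + 5) ≤ n + t (r + 4) then 1 else 0 :=
      fun _ => b_block_two (r := r + 2)
  have hs : hi .two (r + 2) - lo .two (r + 2) = t (r + 3) := hi_two_sub (r + 2)
  have hl : lo .two (r + 2) = t (r + 5) + D (r + 3) := rfl
  rw [bVec_eq .two (r + 2), bCat_eq, hs, hl, e1]
  refine map_range'_eq_zipWith (by omega) fun i hi => ?_
  rw [hb _ (by omega) (by omega),
    show t (r + 5) + D (r + 3) + 1 + i - t (r + 5) = D (r + 3) + 1 + i by omega]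
  split_ifs <;> omega

theorem bVec_three_succ (r : ℕ) : bVec .three (r + 7) = List.zipWith (· + ·) (bCat (r + 4))
    (List.replicate (t (r + 3) + 1 - k (r + 4)) 1 ++ List.replicate (k (r + 4) - 1) 0) := by
  have e1 := k_eq r
  have e2 := D_lt_t_succ r
  have e3 : t (r + 1) < t (r + 3) := t_strictMono (by omega)
  have e4 : D (r + 6) = D (r + 3) + t (r + 6) := D_add_three (r + 3)
  have e5 : D (r + 4) = D (r + 3) + t (r + 3) := D_succ (r + 3)
  have e6 := D_add_three r
  have hb : ∀ n, D (r + 6) < n → n ≤ t (r + 6) + D (r + 4) →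
    b n = b (n - t (r + 6)) + if n < t (r + 6) + 2 * t (r + 3) then 1 else 0 :=
      fun _ => b_block_three (r := r + 3)
  have hs : hi .three (r + 3) - lo .three (r + 3) = t (r + 3) := hi_three_sub (r + 3)
  have hl : lo .three (r + 3) = D (r + 6) := rfl
  rw [bVec_eq .three (r + 3), bCat_eq, hs, hl, e1]
  refine map_range'_eq_zipWith (by omega) fun i hi => ?_
  rw [hb _ (by omega) (by omega),
    show D (r + 6) + 1 + i - t (r + 6) = D (r + 3) + 1 + i by omega]
  split_ifs <;> omega

/-- The listed values of `b`. -/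
lemma b_initial {i : ℕ} (h : i ≤ 20 ∨ 28 ≤ i ∧ i ≤ 31) : (b i : ℤ) = initB i := by
  obtain ⟨d1, d2, d3, d4, d5, d6⟩ := D_values
  obtain ⟨t3, t4, t5, t6⟩ := t_values
  have t0 := t_zero
  have t1 := t_one
  have t2 := t_two
  have z : ∀ i ≤ 7, b i = 0 := fun i hi => b_eq_zero hi
  have h3 : ∀ r n, D (r + 3) < n → n ≤ t (r + 3) + D (r + 1) →
    b n = b (n - t (r + 3)) + if n < t (r + 3) + 2 * t r then 1 else 0 := fun _ _ => b_block_three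
  have h2 : ∀ r n, t (r + 3) + D (r + 1) < n → n ≤ t (r + 3) + D (r + 2) →
    b n = b (n - t (r + 3)) + if 2 * t (r + 3) ≤ n + t (r + 2) then 1 else 0 :=
      fun _ _ => b_block_two
  have h1 : ∀ r n, t (r + 3) + D (r + 2) < n → n ≤ t (r + 3) + D (r + 3) →
    b n = b (n - t (r + 3)) + if 2 * t (r + 3) ≤ n then 1 else 0 := fun _ _ => b_block_one
  have c30 := h3 0
  have c20 := h2 0
  have c10 := h1 0
  have c31 := h3 1
  have c21 := h2 1
  have c32 := h3 2
  simp only [Nat.reduceAdd, d1, d2, d3, d4, d5, t0, t1, t2, t3, t4, t5] at c30 c20 c10 c31 c21 c32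
  have b8 : b 8 = 1 := by rw [c30 8 (by omega) (by omega), z _ (by omega)]; rfl
  by_cases hi : i ≤ 7
  · rw [z i hi]; interval_cases i <;> rfl
  rcases h with h | h
  · interval_cases i
    · rw [b8]; rfl
    · rw [c20 9 (by omega) (by omega), z _ (by omega)]; rfl
    · rw [c20 10 (by omega) (by omega), z _ (by omega)]; rfl
    · rw [c10 11 (by omega) (by omega), z _ (by omega)]; rfl
    · rw [c10 12 (by omega) (by omega), z _ (by omega)]; rfl
    · rw [c10 13 (by omega) (by omega), z _ (by omega)]; rfl
    · rw [c10 14 (by omega) (by omega), z _ (by omega)]; rfl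
    · rw [c31 15 (by omega) (by omega), z _ (by omega)]; rfl
    · rw [c31 16 (by omega) (by omega), z _ (by omega)]; rfl
    · rw [c21 17 (by omega) (by omega), z _ (by omega)]; rfl
    · rw [c21 18 (by omega) (by omega), z _ (by omega)]; rfl
    · rw [c21 19 (by omega) (by omega), z _ (by omega)]; rfl
    · rw [c21 20 (by omega) (by omega), z _ (by omega)]; rfl
  · obtain ⟨h, h'⟩ := h
    interval_cases i
    · rw [c32 28 (by omega) (by omega), z _ (by omega)]; rfl
    · rw [c32 29 (by omega) (by omega), z _ (by omega)]; rfl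
    · rw [c32 30 (by omega) (by omega), z _ (by omega)]; rfl
    · rw [c32 31 (by omega) (by omega), z _ (by omega)]; rfl

/-! ### Sums of `b` over blocks -/

lemma B_succ (n : ℕ) : B (n + 1) = B n + b (n + 1) := by
  rw [B_eq_sum, B_eq_sum, Finset.sum_Icc_succ_top (by omega)]

lemma B_eq_zero {n : ℕ} (hn : n ≤ 7) : B n = 0 := by
  rw [B_eq_sum]
  exact Finset.sum_eq_zero fun i hi => b_eq_zero ((Finset.mem_Icc.1 hi).2.trans hn)

lemma sum_Icc_b {a n : ℕ} (h : a ≤ n) :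
    ∑ i ∈ Finset.Icc (a + 1) n, (b i : ℚ) = (B n : ℚ) - B a := by
  induction n, h using Nat.le_induction with
  | base => simp
  | succ n h ih =>
    rw [Finset.sum_Icc_succ_top (by omega), ih, B_succ]
    push_cast; ring

lemma part_eq {j : Idx} {r n : ℕ} (h : lo j r ≤ n) :
    part j (r + 4) n = (B n : ℚ) - B (lo j r) := by
  rw [part, gMin_eq, sum_Icc_b h]

lemma sum_map_range' (a L : ℕ) : ((List.range' (a + 1) L).map b).sum + B a = B (a + L) := by
  induction L with
  | zero => simp
  | succ L ih =>
    rw [List.range'_concat, List.map_append, List.sum_append, ← add_assoc a L 1, B_succ, ← ih]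
    simp only [List.map_cons, List.map_nil, List.sum_singleton, one_mul]
    rw [show a + 1 + L = a + L + 1 by omega]
    omega

lemma bSum_eq (j : Idx) (r : ℕ) : (bSum j (r + 4) : ℚ) = (B (hi j r) : ℚ) - B (lo j r) := by
  have h := sum_map_range' (lo j r) (hi j r - lo j r)
  have h' := lo_lt_hi j r
  rw [← bVec_eq, Nat.add_sub_cancel' h'.le] at h
  rw [bSum, ← h]
  push_cast; ring

/-- Telescoping of the recursion for `b` over a stretch; the subtracted sums stand on the other
side, so that no truncated difference of values of `B` occurs. -/
lemma B_shift {y a n : ℕ} {e : ℕ → ℕ} (ha : y ≤ a) (han : a ≤ n)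
    (h : ∀ i, a < i → i ≤ n → b i = b (i - y) + e i) :
    B n + B (a - y) = B (n - y) + B a + ∑ i ∈ Finset.Ioc a n, e i := by
  induction n, han using Nat.le_induction with
  | base => simp [add_comm]
  | succ n hn ih =>
    have ih := ih fun i hi hi' => h i hi (by omega)
    have hb := h (n + 1) (by omega) le_rfl
    rw [Finset.sum_Ioc_succ_top hn, B_succ, hb, show n + 1 - y = n - y + 1 by omega, B_succ]
    omega

lemma sum_Ioc_ge {a n c : ℕ} (han : a ≤ n) (hc : a < c) :
    ∑ i ∈ Finset.Ioc a n, (if c ≤ i then 1 else 0) = n + 1 - c := by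
  induction n, han using Nat.le_induction with
  | base => simp; omega
  | succ n hn ih =>
    rw [Finset.sum_Ioc_succ_top hn, ih]
    split_ifs <;> omega

lemma sum_Ioc_lt {a n c : ℕ} (han : a ≤ n) (hc : a < c) :
    ∑ i ∈ Finset.Ioc a n, (if i < c then 1 else 0) = min n (c - 1) - a := by
  induction n, han using Nat.le_induction with
  | base => simp
  | succ n hn ih =>
    rw [Finset.sum_Ioc_succ_top hn, ih]
    split_ifs <;> omega

lemma B_block_one {r n : ℕ} (hn : t (r + 3) + D (r + 2) ≤ n) (hn' : n ≤ D (r + 4)) :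
    B n + B (D (r + 2)) =
      B (n - t (r + 3)) + B (t (r + 3) + D (r + 2)) + (n + 1 - 2 * t (r + 3)) := by
  have h1 : D (r + 2) < t (r + 3) := D_lt_t_succ (r + 2)
  have h2 : D (r + 4) = D (r + 3) + t (r + 3) := D_succ (r + 3)
  have h := B_shift (y := t (r + 3)) (by omega) hn fun i hi hi' =>
    b_block_one (r := r) hi (by omega)
  rwa [sum_Ioc_ge hn (by omega), Nat.add_sub_cancel_left] at h

lemma B_block_two {r n : ℕ} (hn : t (r + 3) + D (r + 1) ≤ n) (hn' : n ≤ t (r + 3) + D (r + 2)) :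
    B n + B (D (r + 1)) = B (n - t (r + 3)) + B (t (r + 3) + D (r + 1)) +
      (n + t (r + 2) + 1 - 2 * t (r + 3)) := by
  have h1 := D_lt_t_succ r
  have h2 := D_succ r
  have h3 := t_add_three r
  -- The term `t (r + 2)` is moved across the inequality to give the shape that `sum_Ioc_ge` sums.
  have h := B_shift (y := t (r + 3)) (e := fun i => if 2 * t (r + 3) - t (r + 2) ≤ i then 1 else 0)
    (by omega) hn fun i hi hi' => by
      rw [b_block_two (r := r) hi (by omega)]
      congr 1
      exact if_congr (by omega) rfl rfl
  rw [sum_Ioc_ge hn (by omega), Nat.add_sub_cancel_left] at h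
  rw [h]; omega

lemma D_lt_two_mul (r : ℕ) : D r < 2 * t r := by
  obtain _ | q := r
  · decide
  · have e1 := D_lt_t_succ q
    have e2 := D_succ q
    have e3 := t_lt_succ q
    omega

lemma B_block_three {r n : ℕ} (hn : D (r + 3) ≤ n) (hn' : n ≤ t (r + 3) + D (r + 1)) :
    B n + B (D r) = B (n - t (r + 3)) + B (D (r + 3)) +
      (min n (t (r + 3) + 2 * t r - 1) - D (r + 3)) := by
  have h1 := D_add_three r
  have h3 := D_lt_two_mul r
  have h := B_shift (y := t (r + 3)) (by omega) hn fun i hi hi' =>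
    b_block_three (r := r) hi (by omega)
  rwa [sum_Ioc_lt hn (by omega), h1, Nat.add_sub_cancel, ← h1] at h

/-! ### Closed forms -/

/-- The extra squares on this whole block number `2 t r - D r - 1`; on each of the other two blocks
they number `D r + 1`. -/
lemma B_hi_three (r : ℕ) : B (hi .three r) + B (D r) + D r + 1 =
    B (D (r + 1)) + B (D (r + 3)) + 2 * t r := by
  have h1 := D_add_three r
  have h2 := D_succ r
  have h3 := t_le_D_succ r
  have h := B_block_three (r := r) (n := t (r + 3) + D (r + 1)) (by omega) le_rfl
  have h4 := D_lt_two_mul r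
  rw [Nat.add_sub_cancel_left] at h
  simp only [hi]
  omega

lemma B_hi_two (r : ℕ) : B (hi .two r) + B (D (r + 1)) =
    B (D (r + 2)) + B (hi .three r) + D r + 1 := by
  have h1 := D_add_three r
  have h2 : D (r + 3) = D (r + 2) + t (r + 2) := D_succ (r + 2)
  have h3 := t_pos (r + 1)
  have h4 : D (r + 2) = D (r + 1) + t (r + 1) := D_succ (r + 1)
  have h := B_block_two (r := r) (n := t (r + 3) + D (r + 2)) (by omega) le_rfl
  rw [Nat.add_sub_cancel_left] at h
  simp only [hi]
  omega

lemma B_hi_one (r : ℕ) : B (D (r + 4)) + B (D (r + 2)) =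
    B (D (r + 3)) + B (hi .two r) + D r + 1 := by
  have h1 := D_add_three r
  have h2 : D (r + 4) = D (r + 3) + t (r + 3) := D_succ (r + 3)
  have h3 : D (r + 3) = D (r + 2) + t (r + 2) := D_succ (r + 2)
  have h := B_block_one (r := r) (n := D (r + 4)) (by omega) le_rfl
  rw [h2, Nat.add_sub_cancel, ← h2] at h
  simp only [hi]
  omega

lemma D_cast (r : ℕ) : (D r : ℚ) = ((t (r + 2) : ℚ) - t r - 3) / 2 := by
  have h1 := D_closed r
  have h2 := D_succ r
  have : 2 * D r + 3 + t r = t (r + 2) := by omega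
  rw [← this]; push_cast; ring

lemma t_cast (r : ℕ) : (t (r + 3) : ℚ) = t (r + 2) + t (r + 1) + t r := by
  exact_mod_cast t_add_three r

/-- Adding the three block identities gives a fourth-order recurrence with four vanishing initial
values, at `D 0, …, D 3 ≤ 7`. All other closed forms follow from this one linearly. -/
lemma B_D_eq (r : ℕ) : (B (D r) : ℚ) =
    (r : ℚ) / 44 * (-15 * t r + 8 * t (r + 1) + 5 * t (r + 2))
      + 1 / 44 * (105 * t r - 51 * t (r + 2)) + ((r : ℚ) + 9) / 4 := by
  obtain ⟨d1, d2, d3, -⟩ := D_values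
  obtain ⟨t3, t4, t5, -⟩ := t_values
  have hrec : ∀ r, (B (D (r + 4)) : ℚ) = 2 * B (D (r + 3)) - B (D r) + 2 * t r + D r + 1 := by
    intro r
    have h3 := B_hi_three r
    have h2 := B_hi_two r
    have h1 := B_hi_one r
    have : B (D (r + 4)) + B (D r) = 2 * B (D (r + 3)) + 2 * t r + D r + 1 := by omega
    have : ((B (D (r + 4)) + B (D r) : ℕ) : ℚ) =
      ((2 * B (D (r + 3)) + 2 * t r + D r + 1 : ℕ) : ℚ) := by rw [this]
    push_cast at this
    linarith
  induction r using Nat.strong_induction_on with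
  | _ r ih =>
    match r with
    | 0 =>
      rw [B_eq_zero (by decide)]
      simp only [zero_add, t_two, t_one, t_zero]; norm_num
    | 1 =>
      rw [B_eq_zero (by omega)]
      simp only [Nat.reduceAdd, t3, t_two, t_one]; norm_num
    | 2 =>
      rw [B_eq_zero (by omega)]
      simp only [Nat.reduceAdd, t4, t3, t_two]; norm_num
    | 3 =>
      rw [B_eq_zero (by omega)]
      simp only [Nat.reduceAdd, t5, t4, t3]; norm_num
    | r + 4 =>
      have T0 := t_cast r
      have T1 : (t (r + 4) : ℚ) = t (r + 3) + t (r + 2) + t (r + 1) := t_cast (r + 1)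
      have T2 : (t (r + 5) : ℚ) = t (r + 4) + t (r + 3) + t (r + 2) := t_cast (r + 2)
      have T3 : (t (r + 6) : ℚ) = t (r + 5) + t (r + 4) + t (r + 3) := t_cast (r + 3)
      rw [hrec r, ih (r + 3) (by omega), ih r (by omega), D_cast r]
      simp only [Nat.add_assoc, Nat.reduceAdd]
      rw [T3, T2, T1, T0]
      push_cast
      ring

lemma form_ofLevel (r : ℕ) (d a₁ a₂ a₃ e c₁ c₂ c₃ : ℚ) :
    (Trip.ofLevel (r + 4)).form d a₁ a₂ a₃ e c₁ c₂ c₃ =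
      ((r : ℚ) + 4) / d * (a₁ * t (r + 4) + a₂ * t (r + 3) + a₃ * t (r + 2))
        + 1 / e * (c₁ * t (r + 4) + c₂ * t (r + 3) + c₃ * t (r + 2)) := by
  change ((r + 4 : ℕ) : ℚ) / d * (a₁ * ((t (r + 4) : ℤ) : ℚ) + a₂ * ((t (r + 3) : ℤ) : ℚ)
    + a₃ * ((t (r + 2) : ℤ) : ℚ)) + 1 / e * (c₁ * ((t (r + 4) : ℤ) : ℚ)
    + c₂ * ((t (r + 3) : ℤ) : ℚ) + c₃ * ((t (r + 2) : ℤ) : ℚ)) = _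
  push_cast; rfl

lemma m_ofLevel (r : ℕ) : ((Trip.ofLevel (r + 4)).m : ℚ) = (r : ℚ) + 4 := by
  change ((r + 4 : ℕ) : ℚ) = _
  push_cast; rfl

theorem B_hi_eq (j : Idx) (r : ℕ) : (B (hi j r) : ℚ) = (Trip.ofLevel (r + 4)).maxForm j := by
  have e0 := B_D_eq r
  have e1 := B_D_eq (r + 1)
  have e2 := B_D_eq (r + 2)
  have e3 := B_D_eq (r + 3)
  have e4 := B_D_eq (r + 4)
  have h2 : ((B (hi .two r) + B (D (r + 1)) : ℕ) : ℚ) =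
    ((B (D (r + 2)) + B (hi .three r) + D r + 1 : ℕ) : ℚ) := by rw [B_hi_two]
  have h3 : ((B (hi .three r) + B (D r) + D r + 1 : ℕ) : ℚ) =
    ((B (D (r + 1)) + B (D (r + 3)) + 2 * t r : ℕ) : ℚ) := by rw [B_hi_three]
  have eD := D_cast r
  have T0 := t_cast r
  have T1 : (t (r + 4) : ℚ) = t (r + 3) + t (r + 2) + t (r + 1) := t_cast (r + 1)
  have T2 : (t (r + 5) : ℚ) = t (r + 4) + t (r + 3) + t (r + 2) := t_cast (r + 2)
  have T3 : (t (r + 6) : ℚ) = t (r + 5) + t (r + 4) + t (r + 3) := t_cast (r + 3)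
  push_cast at h2 h3 e0 e1 e2 e3 e4
  simp only [Nat.add_assoc, Nat.reduceAdd] at e0 e1 e2 e3 e4
  have f3 : (B (hi .three r) : ℚ) = B (D (r + 1)) + B (D (r + 3)) + 2 * t r - B (D r) - D r - 1 := by
    linarith
  have f2 : (B (hi .two r) : ℚ) = B (D (r + 2)) + B (hi .three r) + D r + 1 - B (D (r + 1)) := by
    linarith
  cases j
  · simp only [hi, Trip.maxForm, form_ofLevel, m_ofLevel, e4, T3, T2, T1, T0]
    ring
  · simp only [f2, f3, Trip.maxForm, form_ofLevel, m_ofLevel, e0, e2, e3, eD, T2, T1, T0]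
    ring
  · simp only [f3, Trip.maxForm, form_ofLevel, m_ofLevel, e0, e1, e3, eD, T2, T1, T0]
    ring

theorem bSum_eq_sumForm (j : Idx) (r : ℕ) :
    (bSum j (r + 4) : ℚ) = (Trip.ofLevel (r + 4)).sumForm j := by
  have e3 := B_D_eq (r + 3)
  have T0 := t_cast r
  have T1 : (t (r + 4) : ℚ) = t (r + 3) + t (r + 2) + t (r + 1) := t_cast (r + 1)
  have T2 : (t (r + 5) : ℚ) = t (r + 4) + t (r + 3) + t (r + 2) := t_cast (r + 2)
  push_cast at e3
  simp only [Nat.add_assoc, Nat.reduceAdd] at e3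
  rw [bSum_eq, B_hi_eq]
  cases j
  · rw [show lo .one r = hi .two r from rfl, B_hi_eq]
    simp only [Trip.maxForm, Trip.sumForm, form_ofLevel, m_ofLevel]
    ring
  · rw [show lo .two r = hi .three r from rfl, B_hi_eq]
    simp only [Trip.maxForm, Trip.sumForm, form_ofLevel, m_ofLevel]
    ring
  · rw [show lo .three r = D (r + 3) from rfl, e3]
    simp only [Trip.maxForm, Trip.sumForm, form_ofLevel, m_ofLevel, T2, T1, T0]
    ring

lemma Phi_eq (r : ℕ) : (Phi (r + 4) : ℚ) = (B (D (r + 4)) : ℚ) - B (D (r + 3)) := by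
  rw [Phi]
  push_cast
  rw [bSum_eq, bSum_eq, bSum_eq]
  simp only [lo, hi]
  ring

theorem Phi_eq_phiForm (r : ℕ) : (Phi (r + 4) : ℚ) = (Trip.ofLevel (r + 4)).phiForm := by
  rw [Phi]
  push_cast
  rw [bSum_eq_sumForm, bSum_eq_sumForm, bSum_eq_sumForm]
  simp only [Trip.sumForm, Trip.phiForm, form_ofLevel]
  ring

theorem sum_Phi_eq (r : ℕ) :
    ∑ i ∈ Finset.Icc 4 (r + 3), (Phi i : ℚ) = (Trip.ofLevel (r + 4)).phiSumForm := by
  have h : ∀ r, ∑ i ∈ Finset.Icc 4 (r + 3), (Phi i : ℚ) = B (D (r + 3)) := by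
    intro r
    induction r with
    | zero => rw [zero_add, D_values.2.2.1, B_eq_zero le_rfl]; simp
    | succ r ih =>
      rw [show r + 1 + 3 = r + 3 + 1 by omega, Finset.sum_Icc_succ_top (by omega), ih]
      have := Phi_eq r
      simp only [Nat.add_assoc, Nat.reduceAdd] at this ⊢
      rw [this]; ring
  have e3 := B_D_eq (r + 3)
  have T1 : (t (r + 4) : ℚ) = t (r + 3) + t (r + 2) + t (r + 1) := t_cast (r + 1)
  have T2 : (t (r + 5) : ℚ) = t (r + 4) + t (r + 3) + t (r + 2) := t_cast (r + 2)
  push_cast at e3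
  simp only [Nat.add_assoc, Nat.reduceAdd] at e3
  rw [h, e3]
  simp only [Trip.phiSumForm, form_ofLevel, m_ofLevel, T2, T1]
  ring

/-! ### Reduction of the partial block sums -/

/-- Translation by `t (r + 4)` carries the block onto the whole of level `r + 4`. The cases record
in which of its three blocks the translate falls and whether the extra square has started. -/
theorem part_one_succ {r n : ℕ} (h : n ∈ block .one (r + 5) 1) :
    part .one (r + 5) n =
      if (n : ℤ) < (Trip.ofLevel (r + 5)).θ8 then
        part .three (r + 4) (n - t (r + 4))
      else if (n : ℤ) < (Trip.ofLevel (r + 5)).θ9 then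
        part .two (r + 4) (n - t (r + 4)) + bSum .three (r + 4)
      else if (n : ℤ) < (Trip.ofLevel (r + 5)).η3 then
        part .one (r + 4) (n - t (r + 4)) + bSum .three (r + 4) + bSum .two (r + 4)
      else
        part .one (r + 4) (n - t (r + 4)) + bSum .three (r + 4) + bSum .two (r + 4)
          + n - (Trip.ofLevel (r + 5)).η3 + 1 := by
  obtain ⟨h1, h2⟩ := mem_block_iff (r := r + 1).1 h
  obtain ⟨-, -, -, i1, -, -⟩ := thresholds_one r
  have hη : (Trip.ofLevel (r + 5)).η3 = 2 * (t (r + 4) : ℤ) := rfl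
  have e0 : lo .three r = D (r + 3) := rfl
  have e1 : lo .two r = hi .three r := rfl
  have e2 : lo .one r = hi .two r := rfl
  have e3 := lo_one_succ r
  have e4 := lo_lt_hi .three r
  have e5 := lo_lt_hi .two r
  have hl : lo .one (r + 1) = t (r + 4) + D (r + 3) := rfl
  have key := B_block_one (r := r + 1) h1.le h2
  simp only [Nat.add_assoc, Nat.reduceAdd] at key
  rw [← hl] at key
  -- The truncated difference counts the extra squares: it vanishes before `η3` and is a true
  -- difference from there on.
  generalize hx : n + 1 - 2 * t (r + 4) = x at key
  have key : ((B n + B (D (r + 3)) : ℕ) : ℚ) =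
    ((B (n - t (r + 4)) + B (lo .one (r + 1)) + x : ℕ) : ℚ) := by rw [key, add_assoc]
  rw [θ9_eq, hη] at i1
  rw [θ8_eq, θ9_eq, hη]
  rw [part_eq (r := r + 1) h1.le]
  push_cast at key
  split_ifs with c1 c2 c3
  · obtain rfl : x = 0 := by omega
    rw [part_eq (by omega), e0]
    push_cast at key
    linarith
  · obtain rfl : x = 0 := by omega
    rw [part_eq (by omega), bSum_eq, e1, e0]
    push_cast at key
    linarith
  · obtain rfl : x = 0 := by omega
    rw [part_eq (by omega), bSum_eq, bSum_eq, e2, e1, e0]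
    push_cast at key
    linarith
  · have hx' : (x : ℚ) + 2 * t (r + 4) = n + 1 := by
      have : x + 2 * t (r + 4) = n + 1 := by omega
      exact_mod_cast this
    rw [part_eq (by omega), bSum_eq, bSum_eq, e2, e1, e0]
    push_cast
    linarith

theorem part_two_succ {r n : ℕ} (h : n ∈ block .two (r + 6) 1) :
    part .two (r + 6) n =
      if (n : ℤ) < (Trip.ofLevel (r + 6)).θ5 then
        part .three (r + 4) (n - t (r + 5))
      else if (n : ℤ) < (Trip.ofLevel (r + 6)).η2 then
        part .two (r + 4) (n - t (r + 5)) + bSum .three (r + 4)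
      else if (n : ℤ) < (Trip.ofLevel (r + 6)).θ6 then
        part .two (r + 4) (n - t (r + 5)) + bSum .three (r + 4) + n
          - (Trip.ofLevel (r + 6)).η2 + 1
      else
        part .one (r + 4) (n - t (r + 5)) + bSum .three (r + 4) + bSum .two (r + 4)
          + n - (Trip.ofLevel (r + 6)).η2 + 1 := by
  obtain ⟨h1, h2⟩ := mem_block_iff (r := r + 2).1 h
  obtain ⟨-, -, -, i1, i2, -⟩ := thresholds_two r
  have hη : (Trip.ofLevel (r + 6)).η2 = 2 * (t (r + 5) : ℤ) - t (r + 4) := rfl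
  have e0 : lo .three r = D (r + 3) := rfl
  have e1 : lo .two r = hi .three r := rfl
  have e2 : lo .one r = hi .two r := rfl
  have e3 := lo_two_succ r
  have e4 := lo_lt_hi .three r
  have e5 := lo_lt_hi .two r
  have hl : lo .two (r + 2) = t (r + 5) + D (r + 3) := rfl
  have key := B_block_two (r := r + 2) h1.le h2
  simp only [Nat.add_assoc, Nat.reduceAdd] at key
  rw [← hl] at key
  generalize hx : n + (t (r + 4) + 1) - 2 * t (r + 5) = x at key
  have key : ((B n + B (D (r + 3)) : ℕ) : ℚ) =
    ((B (n - t (r + 5)) + B (lo .two (r + 2)) + x : ℕ) : ℚ) := by rw [key, add_assoc]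
  rw [θ5_eq, hη] at i1
  rw [θ6_eq, hη] at i2
  rw [θ5_eq, θ6_eq, hη]
  rw [part_eq (r := r + 2) h1.le]
  push_cast at key
  split_ifs with c1 c2 c3
  · obtain rfl : x = 0 := by omega
    rw [part_eq (by omega), e0]
    push_cast at key
    linarith
  · obtain rfl : x = 0 := by omega
    rw [part_eq (by omega), bSum_eq, e1, e0]
    push_cast at key
    linarith
  · have hx' : (x : ℚ) + 2 * t (r + 5) = n + t (r + 4) + 1 := by
      have : x + 2 * t (r + 5) = n + t (r + 4) + 1 := by omega
      exact_mod_cast this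
    rw [part_eq (by omega), bSum_eq, e1, e0]
    push_cast
    linarith
  · have hx' : (x : ℚ) + 2 * t (r + 5) = n + t (r + 4) + 1 := by
      have : x + 2 * t (r + 5) = n + t (r + 4) + 1 := by omega
      exact_mod_cast this
    rw [part_eq (by omega), bSum_eq, bSum_eq, e2, e1, e0]
    push_cast
    linarith

theorem part_three_succ {r n : ℕ} (h : n ∈ block .three (r + 7) 1) :
    part .three (r + 7) n =
      if (n : ℤ) < (Trip.ofLevel (r + 7)).θ2 then
        part .three (r + 4) (n - t (r + 6)) + n - gMin .three (r + 7) 1 + 1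
      else if (n : ℤ) < (Trip.ofLevel (r + 7)).θ3 then
        part .two (r + 4) (n - t (r + 6)) + bSum .three (r + 4) + n - gMin .three (r + 7) 1 + 1
      else if (n : ℤ) < (Trip.ofLevel (r + 7)).η1 then
        part .one (r + 4) (n - t (r + 6)) + bSum .three (r + 4) + bSum .two (r + 4)
          + n - gMin .three (r + 7) 1 + 1
      else
        part .one (r + 4) (n - t (r + 6)) + bSum .three (r + 4) + bSum .two (r + 4)
          + (-5 * (t (r + 7) : ℚ) + 10 * t (r + 6) - t (r + 5) + 1) / 2 := by
  obtain ⟨h1, h2⟩ := mem_block_iff (r := r + 3).1 h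
  obtain ⟨-, -, -, i1, i2, -⟩ := thresholds_three r
  have hη : (Trip.ofLevel (r + 7)).η1 = (t (r + 6) : ℤ) + 2 * t (r + 3) := η1_eq (r + 3)
  have hg : gMin .three (r + 7) 1 = lo .three (r + 3) + 1 := gMin_eq .three (r + 3)
  have e0 : lo .three r = D (r + 3) := rfl
  have e1 : lo .two r = hi .three r := rfl
  have e2 : lo .one r = hi .two r := rfl
  have e3 := lo_three_succ r
  have e4 := lo_lt_hi .three r
  have e5 := lo_lt_hi .two r
  have hl : lo .three (r + 3) = D (r + 6) := rfl
  have key := B_block_three (r := r + 3) h1.le h2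
  simp only [Nat.add_assoc, Nat.reduceAdd] at key
  rw [← hl] at key
  generalize hx : min n (t (r + 6) + 2 * t (r + 3) - 1) - lo .three (r + 3) = x at key
  have key : ((B n + B (D (r + 3)) : ℕ) : ℚ) =
    ((B (n - t (r + 6)) + B (lo .three (r + 3)) + x : ℕ) : ℚ) := by rw [key, add_assoc]
  rw [θ3_eq, hη] at i1
  rw [θ2_eq, θ3_eq, hη, hg]
  rw [part_eq (r := r + 3) h1.le]
  push_cast at key
  -- Before `η1` every position of the block so far carries one extra square; afterwards their
  -- number stays constant.
  have hx1 : (n : ℤ) < (t (r + 6) : ℤ) + 2 * t (r + 3) → (x : ℚ) + lo .three (r + 3) = n := by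
    intro hn
    have : x + lo .three (r + 3) = n := by omega
    exact_mod_cast this
  split_ifs with c1 c2 c3
  · have := hx1 (by omega)
    rw [part_eq (by omega), e0]
    push_cast
    linarith
  · have := hx1 (by omega)
    rw [part_eq (by omega), bSum_eq, e1, e0]
    push_cast
    linarith
  · have := hx1 c3
    rw [part_eq (by omega), bSum_eq, bSum_eq, e2, e1, e0]
    push_cast
    linarith
  -- The constant `t (r + 6) + 2 t (r + 3) - 1 - D (r + 6)` is rewritten with `t (r + 3) = 2 t (r +
  -- 6) - t (r + 7)`.
  · have hx' : 2 * x + 5 * t (r + 7) + t (r + 5) = 10 * t (r + 6) + 1 := by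
      have d1 : 2 * D (r + 6) + 3 = t (r + 7) + t (r + 5) := D_closed (r + 5)
      have T3 : t (r + 6) = t (r + 5) + t (r + 4) + t (r + 3) := t_add_three (r + 3)
      have T4 : t (r + 7) = t (r + 6) + t (r + 5) + t (r + 4) := t_add_three (r + 4)
      have d2 : D (r + 6) = D (r + 3) + t (r + 6) := D_add_three (r + 3)
      have L3 : t (r + 3) ≤ D (r + 3) + 1 := t_le_D_succ (r + 3)
      have h3 : D (r + 3) < 2 * t (r + 3) := D_lt_two_mul (r + 3)
      omega
    have hx' : 2 * (x : ℚ) + 5 * t (r + 7) + t (r + 5) = 10 * t (r + 6) + 1 := by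
      exact_mod_cast hx'
    rw [part_eq (by omega), bSum_eq, bSum_eq, e2, e1, e0]
    linarith

/-! ### The algorithms -/

lemma down_ofLevel (r : ℕ) : (Trip.ofLevel (r + 3)).down = Trip.ofLevel (r + 2) := by
  have h := t_add_three r
  change (⟨r + 3 - 1, t (r + 2), t (r + 1), (t (r + 3) : ℤ) - t (r + 2) - t (r + 1)⟩ : Trip) =
    ⟨r + 2, t (r + 2), t (r + 1), t r⟩
  congr 1
  omega

lemma up_ofLevel (r : ℕ) : (Trip.ofLevel (r + 2)).up = Trip.ofLevel (r + 3) := by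
  have h := t_add_three r
  change (⟨r + 2 + 1, (t (r + 2) : ℤ) + t (r + 1) + t r, t (r + 2), t (r + 1)⟩ : Trip) =
    ⟨r + 3, t (r + 3), t (r + 2), t (r + 1)⟩
  congr 1
  omega

lemma idx_spec {r n : ℕ} (h : D (r + 3) < n ∧ n ≤ D (r + 4)) :
    lo ((Trip.ofLevel (r + 4)).idx n) r < n ∧ n ≤ hi ((Trip.ofLevel (r + 4)).idx n) r := by
  have e1 : lo .two r = hi .three r := rfl
  have e2 : lo .one r = hi .two r := rfl
  have e3 : lo .three r = D (r + 3) := rfl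
  have e4 : hi .one r = D (r + 4) := rfl
  rw [Trip.idx, θ4_eq, θ7_eq]
  split_ifs <;> omega

/-- Any fuel not below the distance `d` gives the same result, and the count returned is exactly
`d`. -/
lemma search_eq (d : ℕ) {r n fuel : ℕ} (hd : d ≤ fuel) (h : D (r + d + 3) < n)
    (h' : n ≤ D (r + d + 4)) :
    search fuel (Trip.ofLevel (r + 4)) n = (Trip.ofLevel (r + d + 4), d) := by
  induction d generalizing r fuel with
  | zero =>
    cases fuel with
    | zero => rfl
    | succ fuel =>
      have : (n : ℤ) < (Trip.ofLevel (r + 4)).θ10 := by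
        rw [θ10_eq, hi]
        have : n ≤ D (r + 4) := h'
        omega
      rw [search, if_pos this, add_zero]
  | succ d ih =>
    obtain ⟨fuel, rfl⟩ : ∃ f, fuel = f + 1 := ⟨fuel - 1, by omega⟩
    have : ¬ (n : ℤ) < (Trip.ofLevel (r + 4)).θ10 := by
      rw [θ10_eq, hi]
      have := D_strictMono.monotone (show r + 4 ≤ r + (d + 1) + 3 by omega)
      omega
    rw [search, if_neg this, up_ofLevel (r + 2)]
    have e : r + 1 + d = r + (d + 1) := by omega
    have := ih (r := r + 1) (fuel := fuel) (by omega) (by rwa [e]) (by rwa [e])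
    rw [e] at this
    simp only [Nat.add_assoc, Nat.reduceAdd] at this ⊢
    rw [this]

lemma level_eq {r n : ℕ} (h : D (r + 3) < n ∧ n ≤ D (r + 4)) :
    level n = (Trip.ofLevel (r + 4), r) := by
  -- The fuel `n` suffices, because `r + 3 ≤ D (r + 3) < n`.
  have hr : r ≤ n := by
    have := D_strictMono.le_apply (x := r + 3)
    omega
  have h0 : (⟨4, 13, 7, 4⟩ : Trip) = Trip.ofLevel (0 + 4) := rfl
  have := search_eq r (r := 0) hr (by rw [zero_add]; exact h.1) (by rw [zero_add]; exact h.2)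
  rwa [zero_add r, ← h0] at this

lemma cast_sub_level {n m : ℕ} (h : t (m - 1) ≤ n) :
    (n : ℤ) - (Trip.ofLevel m).y = ((n - t (m - 1) : ℕ) : ℤ) := by
  rw [Nat.cast_sub h]; rfl

/-- The largest `r` such that `b` is listed on the block `j` of level `r + 4`. -/
def lastListed : Idx → ℕ
  | .one => 0
  | .two => 1
  | .three => 2

lemma initial_range {j : Idx} {r n : ℕ} (h : lo j r < n ∧ n ≤ hi j r)
    (hr : r ≤ lastListed j) :
    n ≤ 20 ∨ 28 ≤ n ∧ n ≤ 31 := by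
  obtain ⟨d1, d2, d3, d4, d5, d6⟩ := D_values
  obtain ⟨t3, t4, t5, t6⟩ := t_values
  cases j
  · have hr : r ≤ 0 := hr
    interval_cases r; simp only [lo, hi, zero_add] at h; omega
  · have hr : r ≤ 1 := hr
    interval_cases r <;> simp only [lo, hi, Nat.reduceAdd, zero_add] at h <;> omega
  · have hr : r ≤ 2 := hr
    interval_cases r <;> simp only [lo, hi, Nat.reduceAdd, zero_add] at h <;> omega

/-! ### Correctness of the block procedures. -/

theorem bBlock_eq (r : ℕ) {j : Idx} {n : ℕ} (h : lo j r < n ∧ n ≤ hi j r) :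
    (bBlock j (Trip.ofLevel (r + 4)) n).1 = b n := by
  induction r using Nat.strong_induction_on generalizing j n with
  | _ r ih =>
    have hm : ∀ r, (Trip.ofLevel (r + 4)).m = r + 4 := fun _ => rfl
    have hy := t_le_lo j r
    have hlev : ∀ q, lo .three q < n - t (r + 3) ∧ n - t (r + 3) ≤ hi .one q → q < r →
        (bBlock ((Trip.ofLevel (q + 4)).idx ((n - t (r + 3) : ℕ) : ℤ)) (Trip.ofLevel (q + 4))
          ((n - t (r + 3) : ℕ) : ℤ)).1 = b (n - t (r + 3)) :=
      fun q hq hqr => ih q hqr (idx_spec hq)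
    have hcast : (n : ℤ) - (Trip.ofLevel (r + 4)).y = ((n - t (r + 3) : ℕ) : ℤ) :=
      cast_sub_level (m := r + 4) (show t (r + 3) ≤ n by omega)
    cases j
    · rw [bBlock, hm]
      by_cases hr : r ≤ 0
      · rw [if_pos (by omega), b_initial (initial_range h hr)]
      · obtain ⟨q, rfl⟩ : ∃ q, r = q + 1 := ⟨r - 1, by omega⟩
        rw [if_neg (by omega)]
        have e : (Trip.ofLevel (q + 1 + 4)).down = Trip.ofLevel (q + 4) := down_ofLevel (q + 2)
        have e1 := lo_one_succ q
        have e2 := hi_one_succ q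
        have et : t (q + 1 + 3) = t (q + 4) := rfl
        have hη : (Trip.ofLevel (q + 1 + 4)).η3 = 2 * (t (q + 1 + 3) : ℤ) := rfl
        simp only [e, hcast, hη]
        rw [hlev q (by omega) (by omega), b_block_one (n := n) h.1 (by
          have : hi .one q = D (q + 1 + 3) := rfl
          omega)]
        push_cast
        congr 1
        exact if_congr (by omega) rfl rfl
    · rw [bBlock, hm]
      by_cases hr : r ≤ 1
      · rw [if_pos (by omega), b_initial (initial_range h hr)]
      · obtain ⟨q, rfl⟩ : ∃ q, r = q + 2 := ⟨r - 2, by omega⟩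
        rw [if_neg (by omega)]
        have e : (Trip.ofLevel (q + 2 + 4)).down.down = Trip.ofLevel (q + 4) := by
          rw [down_ofLevel (q + 3)]; exact down_ofLevel (q + 2)
        have e1 := lo_two_succ q
        have e2 := hi_two_succ q
        have et : t (q + 2 + 3) = t (q + 5) := rfl
        have hη : (Trip.ofLevel (q + 2 + 4)).η2 = 2 * (t (q + 2 + 3) : ℤ) - t (q + 2 + 2) := rfl
        simp only [e, hcast, hη]
        rw [hlev q (by omega) (by omega), b_block_two (n := n) h.1 h.2]
        push_cast
        congr 1
        exact if_congr (by omega) rfl rfl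
    · rw [bBlock, hm]
      by_cases hr : r ≤ 2
      · rw [if_pos (by omega), b_initial (initial_range h hr)]
      · obtain ⟨q, rfl⟩ : ∃ q, r = q + 3 := ⟨r - 3, by omega⟩
        rw [if_neg (by omega)]
        have e : (Trip.ofLevel (q + 3 + 4)).down.down.down = Trip.ofLevel (q + 4) := by
          rw [down_ofLevel (q + 4)]
          exact (congrArg Trip.down (down_ofLevel (q + 3))).trans (down_ofLevel (q + 2))
        have e1 := lo_three_succ q
        have e2 := hi_three_succ q
        have et : t (q + 3 + 3) = t (q + 6) := rfl
        have hη := η1_eq (q + 3)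
        simp only [e, hcast, hη]
        rw [hlev q (by omega) (by omega), b_block_three (n := n) h.1 h.2]
        push_cast
        congr 1
        exact if_congr (by omega) rfl rfl

theorem bAlg_eq (n : ℕ) : (bAlg n).1 = b n := by
  rw [bAlg]
  by_cases hn : n ≤ 7
  · rw [if_pos hn, b_eq_zero hn]; rfl
  · rw [if_neg hn]
    obtain ⟨r, hr⟩ := exists_level (n := n) (by omega)
    simp only [level_eq hr]
    exact bBlock_eq r (idx_spec hr)

lemma initSum_eq {a n : ℕ} (h : ∀ i, a < i → i ≤ n → i ≤ 20 ∨ 28 ≤ i ∧ i ≤ 31) :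
    initSum ((a : ℤ) + 1) n = ∑ i ∈ Finset.Icc (a + 1) n, (b i : ℚ) := by
  have e : ((n : ℤ) + 1 - ((a : ℤ) + 1)).toNat = n + 1 - (a + 1) := by omega
  -- The list of naturals is coerced to a list of integers through the list monad; this turns the
  -- coercion back into a `map`.
  have e' : ∀ l : List ℕ, (do let i ← l; pure (i : ℤ)) = l.map Nat.cast := fun _ =>
    List.map_eq_flatMap.symm
  rw [initSum, e, e', List.map_map, ← Finset.Ico_add_one_right_eq_Icc,
    Finset.sum_Ico_eq_sum_range, ← List.sum_toFinset _ List.nodup_range, List.toFinset_range]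
  refine Finset.sum_congr rfl fun i hi => ?_
  have hi := Finset.mem_range.1 hi
  have := b_initial (h (a + 1 + i) (by omega) (by omega))
  rw [show ((b (a + 1 + i) : ℕ) : ℚ) = ((b (a + 1 + i) : ℤ) : ℚ) by norm_cast, this]
  push_cast; rfl

lemma initSum_part {j : Idx} {r n : ℕ} (h : n ≤ hi j r)
    (hr : r ≤ lastListed j) :
    initSum ((lo j r : ℤ) + 1) n = part j (r + 4) n := by
  rw [part, gMin_eq]
  exact initSum_eq fun i h1 h2 => initial_range (j := j) ⟨h1, h2.trans h⟩ hr

/-- Correctness of the reduction of partial block sums, and the number of its steps. -/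
theorem partAlg_eq (r : ℕ) {j : Idx} {n : ℕ} (h : lo j r < n ∧ n ≤ hi j r) :
    (partAlg j (Trip.ofLevel (r + 4)) n).1 = part j (r + 4) n ∧
      (partAlg j (Trip.ofLevel (r + 4)) n).2 ≤ r := by
  induction r using Nat.strong_induction_on generalizing j n with
  | _ r ih =>
    have hm : ∀ r, (Trip.ofLevel (r + 4)).m = r + 4 := fun _ => rfl
    have l1 : ∀ q, lo .two q = hi .three q := fun _ => rfl
    have l2 : ∀ q, lo .one q = hi .two q := fun _ => rfl
    by_cases hr : r ≤ lastListed j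
    · have hb := initSum_part h.2 hr
      cases j
      · rw [partAlg, hm, if_pos (show r + 4 ≤ 4 from Nat.add_le_add_right hr 4), θ7_eq]
        exact ⟨hb, Nat.zero_le _⟩
      · rw [partAlg, hm, if_pos (show r + 4 ≤ 5 from Nat.add_le_add_right hr 4), θ4_eq]
        exact ⟨hb, Nat.zero_le _⟩
      · rw [partAlg, hm, if_pos (show r + 4 ≤ 6 from Nat.add_le_add_right hr 4), θ1_eq]
        exact ⟨hb, Nat.zero_le _⟩
    cases j
    · obtain ⟨q, rfl⟩ : ∃ q, r = q + 1 := ⟨r - 1, by simp only [lastListed] at hr; omega⟩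
      change (partAlg .one (Trip.ofLevel (q + 5)) n).1 = part .one (q + 5) n ∧
        (partAlg .one (Trip.ofLevel (q + 5)) n).2 ≤ q + 1
      have e : (Trip.ofLevel (q + 5)).down = Trip.ofLevel (q + 4) := down_ofLevel (q + 2)
      have e1 := lo_one_succ q
      have e2 := hi_one_succ q
      have hcast : (n : ℤ) - (Trip.ofLevel (q + 5)).y = ((n - t (q + 4) : ℕ) : ℤ) :=
        cast_sub_level (m := q + 5) (show t (q + 4) ≤ n by omega)
      have i1 := (thresholds_one q).2.2.2.1
      have ih := fun j => ih q (by omega) (j := j) (n := n - t (q + 4))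
      have f1 := l1 q
      have f2 := l2 q
      have hθ8 := θ8_eq q
      have hθ9 := θ9_eq q
      rw [part_one_succ (r := q) (mem_block_iff.2 h), partAlg,
        if_neg (show ¬ (Trip.ofLevel (q + 5)).m ≤ 4 by change ¬ q + 5 ≤ 4; omega)]
      simp only [e, hcast, ← bSum_eq_sumForm]
      split_ifs with c1 c2 c3
      · obtain ⟨a1, a2⟩ := ih .three (by omega)
        exact ⟨a1, by omega⟩
      · obtain ⟨a1, a2⟩ := ih .two (by omega)
        exact ⟨by rw [a1], by omega⟩
      · obtain ⟨a1, a2⟩ := ih .one (by omega)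
        exact ⟨by rw [a1], by omega⟩
      · obtain ⟨a1, a2⟩ := ih .one (by omega)
        exact ⟨by rw [a1]; push_cast; rfl, by omega⟩
    · obtain ⟨q, rfl⟩ : ∃ q, r = q + 2 := ⟨r - 2, by simp only [lastListed] at hr; omega⟩
      change (partAlg .two (Trip.ofLevel (q + 6)) n).1 = part .two (q + 6) n ∧
        (partAlg .two (Trip.ofLevel (q + 6)) n).2 ≤ q + 2
      have e : (Trip.ofLevel (q + 6)).down.down = Trip.ofLevel (q + 4) := by
        rw [down_ofLevel (q + 3)]; exact down_ofLevel (q + 2)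
      have e1 := lo_two_succ q
      have e2 := hi_two_succ q
      have hcast : (n : ℤ) - (Trip.ofLevel (q + 6)).y = ((n - t (q + 5) : ℕ) : ℤ) :=
        cast_sub_level (m := q + 6) (show t (q + 5) ≤ n by omega)
      have i1 := (thresholds_two q).2.2.2.1
      have i2 := (thresholds_two q).2.2.2.2.1
      have ih := fun j => ih q (by omega) (j := j) (n := n - t (q + 5))
      have f1 := l1 q
      have f2 := l2 q
      have hθ5 := θ5_eq q
      have hθ6 := θ6_eq q
      rw [part_two_succ (r := q) (mem_block_iff.2 h), partAlg,
        if_neg (show ¬ (Trip.ofLevel (q + 6)).m ≤ 5 by change ¬ q + 6 ≤ 5; omega)]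
      simp only [e, hcast, ← bSum_eq_sumForm]
      split_ifs with c1 c2 c3
      · obtain ⟨a1, a2⟩ := ih .three (by omega)
        exact ⟨a1, by omega⟩
      · obtain ⟨a1, a2⟩ := ih .two (by omega)
        exact ⟨by rw [a1], by omega⟩
      · obtain ⟨a1, a2⟩ := ih .two (by omega)
        exact ⟨by rw [a1]; push_cast; rfl, by omega⟩
      · obtain ⟨a1, a2⟩ := ih .one (by omega)
        exact ⟨by rw [a1]; push_cast; rfl, by omega⟩
    · obtain ⟨q, rfl⟩ : ∃ q, r = q + 3 := ⟨r - 3, by simp only [lastListed] at hr; omega⟩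
      change (partAlg .three (Trip.ofLevel (q + 7)) n).1 = part .three (q + 7) n ∧
        (partAlg .three (Trip.ofLevel (q + 7)) n).2 ≤ q + 3
      have e : (Trip.ofLevel (q + 7)).down.down.down = Trip.ofLevel (q + 4) := by
        rw [down_ofLevel (q + 4)]
        exact (congrArg Trip.down (down_ofLevel (q + 3))).trans (down_ofLevel (q + 2))
      have e1 := lo_three_succ q
      have e2 := hi_three_succ q
      have hcast : (n : ℤ) - (Trip.ofLevel (q + 7)).y = ((n - t (q + 6) : ℕ) : ℤ) :=
        cast_sub_level (m := q + 7) (show t (q + 6) ≤ n by omega)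
      have i1 := (thresholds_three q).2.2.2.1
      have ih := fun j => ih q (by omega) (j := j) (n := n - t (q + 6))
      have f1 := l1 q
      have f2 := l2 q
      have hθ2 := θ2_eq q
      have hθ3 := θ3_eq q
      have hθ1 : (((Trip.ofLevel (q + 7)).θ1 : ℤ) : ℚ) = gMin .three (q + 7) 1 := by
        rw [show (Trip.ofLevel (q + 7)).θ1 = _ from θ1_eq (q + 3),
          show gMin .three (q + 7) 1 = _ from gMin_eq .three (q + 3)]
        push_cast; rfl
      rw [part_three_succ (r := q) (mem_block_iff.2 h), partAlg,
        if_neg (show ¬ (Trip.ofLevel (q + 7)).m ≤ 6 by change ¬ q + 7 ≤ 6; omega)]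
      simp only [e, hcast, ← bSum_eq_sumForm, hθ1]
      split_ifs with c1 c2 c3
      · obtain ⟨a1, a2⟩ := ih .three (by omega)
        exact ⟨by rw [a1]; push_cast; rfl, by omega⟩
      · obtain ⟨a1, a2⟩ := ih .two (by omega)
        exact ⟨by rw [a1]; push_cast; rfl, by omega⟩
      · obtain ⟨a1, a2⟩ := ih .one (by omega)
        exact ⟨by rw [a1]; push_cast; rfl, by omega⟩
      · obtain ⟨a1, a2⟩ := ih .one (by omega)
        exact ⟨by rw [a1]; rfl, by omega⟩

theorem algB_eq {n r : ℕ} (hn : 52 ≤ n) (h : D (r + 3) < n ∧ n ≤ D (r + 4)) :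
    (algB n).1 = B n ∧ (algB n).2 ≤ 2 * r := by
  have hj := idx_spec h
  rw [algB, if_neg (by omega)]
  simp only [level_eq h]
  generalize (Trip.ofLevel (r + 4)).idx n = j at hj
  obtain ⟨h1, h2⟩ := partAlg_eq r hj
  refine ⟨?_, by omega⟩
  rw [h1, part_eq hj.1.le]
  -- For `j = 3` the preceding block belongs to the level below, which must still be at least 4;
  -- this is where `n` large is needed.
  have : beforeForm j (Trip.ofLevel (r + 4)) = B (lo j r) := by
    cases j
    · exact (B_hi_eq .two r).symm
    · exact (B_hi_eq .three r).symm
    · have hr := (level_ge hj).1 hn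
      obtain ⟨q, rfl⟩ : ∃ q, r = q + 1 := ⟨r - 1, by omega⟩
      rw [beforeForm, down_ofLevel (q + 2)]
      exact (B_hi_eq .one q).symm
  rw [this]; ring

/-! ### Logarithmic number of steps. -/

lemma two_pow_le_t (q : ℕ) : 2 ^ q ≤ t (2 * q) := by
  induction q with
  | zero => decide
  | succ q ih =>
    have h1 := t_add_two_ge (2 * q)
    have h2 := t_lt_succ (2 * q)
    rw [show 2 * (q + 1) = 2 * q + 2 by omega, pow_succ]
    omega

/-- `2 ^ (r / 2) ≤ t (r + 3) ≤ D (r + 3) < n`. -/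
lemma level_le_log {n r : ℕ} (h : D (r + 3) < n) : r ≤ 2 * Nat.log 2 n + 1 := by
  have h1 := two_pow_le_t (r / 2)
  have h2 := t_strictMono.monotone (show 2 * (r / 2) ≤ r + 3 by omega)
  have h3 := D_add_three r
  have := Nat.le_log_of_pow_le (b := 2) (x := r / 2) (y := n) (by norm_num) (by omega)
  omega

theorem algB_correct (n : ℕ) : (algB n).1 = B n := by
  by_cases hn : n ≤ 51
  · rw [algB, if_pos hn, B_eq_sum]
    push_cast
    refine Finset.sum_congr rfl fun i _ => ?_
    rw [bAlg_eq]; norm_cast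
  · obtain ⟨r, hr⟩ := exists_level (n := n) (by omega)
    exact (algB_eq (by omega) hr).1

theorem algB_steps : ∃ C : ℕ, ∀ n : ℕ, (algB n).2 ≤ C * (Nat.log 2 n + 1) := by
  -- The sum absorbs the finitely many small inputs. For the rest there are at most `2 r` steps, and
  -- `r` is at most `2 * Nat.log 2 n + 1`.
  refine ⟨∑ n ∈ Finset.range 52, (algB n).2 + 4, fun n => ?_⟩
  by_cases hn : n ≤ 51
  · have h1 := Finset.single_le_sum (f := fun n => (algB n).2) (fun _ _ => Nat.zero_le _)
      (Finset.mem_range.2 (show n < 52 by omega))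
    calc (algB n).2 ≤ (∑ n ∈ Finset.range 52, (algB n).2 + 4) * 1 := by omega
      _ ≤ _ := Nat.mul_le_mul_left _ (by omega)
  · obtain ⟨r, hr⟩ := exists_level (n := n) (by omega)
    have h1 := (algB_eq (by omega) hr).2
    have h2 := level_le_log hr.1
    calc (algB n).2 ≤ 4 * (Nat.log 2 n + 1) := by omega
      _ ≤ _ := Nat.mul_le_mul_right _ (by omega)

end TribSq

open TribSq in
theorem mainTheorem5 :
    -- `B` is the summatory function of `b`
    (∀ n : ℕ, B n = ∑ i ∈ Finset.Icc 1 n, b i) ∧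
    -- the blocks `Γ_{j,m,1}`: explicit end points and lengths
    (∀ m : ℕ, 4 ≤ m →
      ((gMin .three m 1 : ℤ) = (Trip.ofLevel m).θ1 ∧ (gMax .three m 1 : ℤ) + 1 = (Trip.ofLevel m).θ4) ∧
      ((gMin .two m 1 : ℤ) = (Trip.ofLevel m).θ4 ∧ (gMax .two m 1 : ℤ) + 1 = (Trip.ofLevel m).θ7) ∧
      ((gMin .one m 1 : ℤ) = (Trip.ofLevel m).θ7 ∧ (gMax .one m 1 : ℤ) + 1 = (Trip.ofLevel m).θ10) ∧
      (block .one m 1).length = t (m - 2) ∧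
      (block .two m 1).length = t (m - 3) ∧
      (block .three m 1).length = t (m - 4)) ∧
    -- they partition the positions `n ≥ 8`, and the levels of large positions are large
    (∀ n : ℕ, 8 ≤ n → ∃! q : Idx × ℕ, 4 ≤ q.2 ∧ n ∈ block q.1 q.2 1) ∧
    (∀ (n m : ℕ) (j : Idx), 4 ≤ m → n ∈ block j m 1 →
      (52 ≤ n → 7 ≤ m) ∧ (32 ≤ n → j = .two → 6 ≤ m) ∧ (21 ≤ n → j = .one → 5 ≤ m)) ∧
    -- the recursive description of `b`
    ((∀ i ≤ 7, b i = 0) ∧ [8].map b = [1] ∧ [9, 10].map b = [0, 1] ∧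
      [11, 12, 13, 14].map b = [0, 0, 0, 1] ∧ [15, 16].map b = [1, 1] ∧
      [17, 18, 19, 20].map b = [0, 0, 1, 1] ∧ [28, 29, 30, 31].map b = [1, 1, 1, 1]) ∧
    (∀ m : ℕ, 5 ≤ m → bVec .one m = List.zipWith (· + ·) (bCat (m - 1))
      (List.replicate (t (m - 2) + 1 - k m) 0 ++ List.replicate (k m - 1) 1)) ∧
    (∀ m : ℕ, 6 ≤ m → bVec .two m = List.zipWith (· + ·) (bCat (m - 2))
      (List.replicate (t (m - 3) + 1 - k m) 0 ++ List.replicate (k m - 1) 1)) ∧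
    (∀ m : ℕ, 7 ≤ m → bVec .three m = List.zipWith (· + ·) (bCat (m - 3))
      (List.replicate (t (m - 4) + 1 - k (m - 3)) 1 ++ List.replicate (k (m - 3) - 1) 0)) ∧
    -- the closed forms
    (∀ m : ℕ, 4 ≤ m →
      (Phi m : ℚ) = (Trip.ofLevel m).phiForm ∧
      (∀ j : Idx, (bSum j m : ℚ) = (Trip.ofLevel m).sumForm j) ∧
      (∑ i ∈ Finset.Icc 4 (m - 1), (Phi i : ℚ)) = (Trip.ofLevel m).phiSumForm ∧
      (∀ j : Idx, (B (gMax j m 1) : ℚ) = (Trip.ofLevel m).maxForm j)) ∧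
    -- the thresholds and the shift by `t_{m-1}`
    (∀ m : ℕ, 7 ≤ m →
      (Trip.ofLevel m).θ2 = gMin .three m 1 + (block .three (m - 3) 1).length ∧
      (Trip.ofLevel m).θ3 = gMin .three m 1 + (block .three (m - 3) 1).length
        + (block .two (m - 3) 1).length ∧
      (Trip.ofLevel m).η1 = gMin .three m 1 + t (m - 4) - k (m - 3) + 1 ∧
      (Trip.ofLevel m).θ3 < (Trip.ofLevel m).η1 ∧ (Trip.ofLevel m).η1 < (Trip.ofLevel m).θ4 ∧
      gMin .three m 1 = gMin .three (m - 3) 1 + t (m - 1)) ∧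
    (∀ m : ℕ, 6 ≤ m →
      (Trip.ofLevel m).θ5 = gMin .two m 1 + (block .three (m - 2) 1).length ∧
      (Trip.ofLevel m).η2 = gMin .two m 1 + t (m - 3) - k m + 1 ∧
      (Trip.ofLevel m).θ6 = gMin .two m 1 + (block .three (m - 2) 1).length
        + (block .two (m - 2) 1).length ∧
      (Trip.ofLevel m).θ5 < (Trip.ofLevel m).η2 ∧ (Trip.ofLevel m).η2 ≤ (Trip.ofLevel m).θ6 ∧
      gMin .two m 1 = gMin .three (m - 2) 1 + t (m - 1)) ∧
    (∀ m : ℕ, 5 ≤ m →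
      (Trip.ofLevel m).θ8 = gMin .one m 1 + (block .three (m - 1) 1).length ∧
      (Trip.ofLevel m).θ9 = gMin .one m 1 + (block .three (m - 1) 1).length
        + (block .two (m - 1) 1).length ∧
      (Trip.ofLevel m).η3 = gMin .one m 1 + t (m - 2) - k m + 1 ∧
      (Trip.ofLevel m).θ9 < (Trip.ofLevel m).η3 ∧ (Trip.ofLevel m).η3 < (Trip.ofLevel m).θ10 ∧
      gMin .one m 1 = gMin .three (m - 1) 1 + t (m - 1)) ∧
    -- the reduction of the partial block sums
    (∀ n m : ℕ, 7 ≤ m → n ∈ block .three m 1 →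
      part .three m n =
        if (n : ℤ) < (Trip.ofLevel m).θ2 then
          part .three (m - 3) (n - t (m - 1)) + n - gMin .three m 1 + 1
        else if (n : ℤ) < (Trip.ofLevel m).θ3 then
          part .two (m - 3) (n - t (m - 1)) + bSum .three (m - 3) + n - gMin .three m 1 + 1
        else if (n : ℤ) < (Trip.ofLevel m).η1 then
          part .one (m - 3) (n - t (m - 1)) + bSum .three (m - 3) + bSum .two (m - 3)
            + n - gMin .three m 1 + 1
        else
          part .one (m - 3) (n - t (m - 1)) + bSum .three (m - 3) + bSum .two (m - 3)
            + (-5 * (t m : ℚ) + 10 * t (m - 1) - t (m - 2) + 1) / 2) ∧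
    (∀ n m : ℕ, 6 ≤ m → n ∈ block .two m 1 →
      part .two m n =
        if (n : ℤ) < (Trip.ofLevel m).θ5 then
          part .three (m - 2) (n - t (m - 1))
        else if (n : ℤ) < (Trip.ofLevel m).η2 then
          part .two (m - 2) (n - t (m - 1)) + bSum .three (m - 2)
        else if (n : ℤ) < (Trip.ofLevel m).θ6 then
          part .two (m - 2) (n - t (m - 1)) + bSum .three (m - 2) + n - (Trip.ofLevel m).η2 + 1
        else
          part .one (m - 2) (n - t (m - 1)) + bSum .three (m - 2) + bSum .two (m - 2)
            + n - (Trip.ofLevel m).η2 + 1) ∧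
    (∀ n m : ℕ, 5 ≤ m → n ∈ block .one m 1 →
      part .one m n =
        if (n : ℤ) < (Trip.ofLevel m).θ8 then
          part .three (m - 1) (n - t (m - 1))
        else if (n : ℤ) < (Trip.ofLevel m).θ9 then
          part .two (m - 1) (n - t (m - 1)) + bSum .three (m - 1)
        else if (n : ℤ) < (Trip.ofLevel m).η3 then
          part .one (m - 1) (n - t (m - 1)) + bSum .three (m - 1) + bSum .two (m - 1)
        else
          part .one (m - 1) (n - t (m - 1)) + bSum .three (m - 1) + bSum .two (m - 1)
            + n - (Trip.ofLevel m).η3 + 1) ∧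
    -- `B(n)` from the preceding block and the partial block sum
    (∀ (n m : ℕ) (j : Idx), 4 ≤ m → n ∈ block j m 1 →
      (B n : ℚ) = B (gMin j m 1 - 1) + part j m n) ∧
    -- the algorithms are correct, and the one for `B` takes `O(log n)` steps
    (∀ n : ℕ, (bAlg n).1 = b n) ∧
    (∀ n : ℕ, (algB n).1 = B n) ∧
    (∃ C : ℕ, ∀ n : ℕ, (algB n).2 ≤ C * (Nat.log 2 n + 1)) := by
  refine ⟨B_eq_sum, ?_, fun n hn => existsUnique_block hn, ?_, ?_, ?_, ?_, ?_, ?_, ?_, ?_, ?_, ?_,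
    ?_, ?_, ?_, bAlg_eq, algB_correct, algB_steps⟩
  · intro m hm
    obtain ⟨r, rfl⟩ := Nat.exists_eq_add_of_le' hm
    refine ⟨⟨?_, ?_⟩, ⟨?_, ?_⟩, ⟨?_, ?_⟩, ?_, ?_, ?_⟩
    · rw [θ1_eq, gMin_eq]; push_cast; rfl
    · rw [θ4_eq, gMax_eq]
    · rw [θ4_eq, gMin_eq]; push_cast; rfl
    · rw [θ7_eq, gMax_eq]
    · rw [θ7_eq, gMin_eq]; push_cast; rfl
    · rw [θ10_eq, gMax_eq]
    · exact (length_block _ _).trans (hi_one_sub r)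
    · exact (length_block _ _).trans (hi_two_sub r)
    · exact (length_block _ _).trans (hi_three_sub r)
  · intro n m j hm h
    obtain ⟨r, rfl⟩ := Nat.exists_eq_add_of_le' hm
    obtain ⟨h1, h2, h3⟩ := level_ge (mem_block_iff.1 h)
    exact ⟨fun a => by have := h1 a; omega, fun a c => by have := h2 a c; omega,
      fun a c => by have := h3 a c; omega⟩
  · have hb : ∀ i v : ℕ, (i ≤ 20 ∨ 28 ≤ i ∧ i ≤ 31) → initB i = v → b i = v := fun i v h hv => by
      have := b_initial h
      omega
    refine ⟨fun i hi => b_eq_zero hi, ?_, ?_, ?_, ?_, ?_, ?_⟩ <;>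
      simp only [List.map_cons, List.map_nil, List.cons.injEq, and_true] <;>
      (repeat' apply And.intro) <;> exact hb _ _ (by omega) rfl
  · intro m hm
    obtain ⟨r, rfl⟩ := Nat.exists_eq_add_of_le' hm
    exact bVec_one_succ r
  · intro m hm
    obtain ⟨r, rfl⟩ := Nat.exists_eq_add_of_le' hm
    exact bVec_two_succ r
  · intro m hm
    obtain ⟨r, rfl⟩ := Nat.exists_eq_add_of_le' hm
    exact bVec_three_succ r
  · intro m hm
    obtain ⟨r, rfl⟩ := Nat.exists_eq_add_of_le' hm
    exact ⟨Phi_eq_phiForm r, fun j => bSum_eq_sumForm j r, sum_Phi_eq r,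
      fun j => by rw [gMax_eq, B_hi_eq]⟩
  · intro m hm
    obtain ⟨r, rfl⟩ := Nat.exists_eq_add_of_le' hm
    exact thresholds_three r
  · intro m hm
    obtain ⟨r, rfl⟩ := Nat.exists_eq_add_of_le' hm
    exact thresholds_two r
  · intro m hm
    obtain ⟨r, rfl⟩ := Nat.exists_eq_add_of_le' hm
    exact thresholds_one r
  · intro n m hm h
    obtain ⟨r, rfl⟩ := Nat.exists_eq_add_of_le' hm
    exact part_three_succ h
  · intro n m hm h
    obtain ⟨r, rfl⟩ := Nat.exists_eq_add_of_le' hm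
    exact part_two_succ h
  · intro n m hm h
    obtain ⟨r, rfl⟩ := Nat.exists_eq_add_of_le' hm
    exact part_one_succ h
  · intro n m j hm h
    obtain ⟨r, rfl⟩ := Nat.exists_eq_add_of_le' hm
    rw [part_eq (mem_block_iff.1 h).1.le, gMin_eq, Nat.add_sub_cancel]
    ring
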